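/- Let $d\in\mathbb N$, let $\Omega=[0,1]^d$ be the $d$-dimensional torus (opposite points identified), and let $T>0$. For $s\in\mathbb R$ let $H^s=H^s(\Omega)$ be the space of real periodic distributions $u$ on $\Omega$ with $$\|u\|_{H^s}^2=\sum_{k\in\mathbb Z^d}(1+4\pi^2|k|^2)^s\,|\hat u(k)|^2<\infty,\qquad \hat u(k)=\langle u,e^{-2\pi i k\cdot x}\rangle .$$ Let the real-valued potential $V$ lie in $C^{1,\infty}=\bigcap_{\beta>0}C^1([0,T],C^\beta(\Omega))$, that is, for every $\beta$ the map $V$ is bounded on $[0,T]$ with values in $C^\beta(\Omega)$ and weakly differentiable in time with derivative essentially bounded in $C^\beta(\Omega)$ (and $V$ is the continuous representative). For $a\in\mathbb R$ and $h\in H^a$, a weak solution of the linear Schrödinger equation $$\partial_t U-\Delta U-VU=0\ \text{ on }(0,T]\times\Omega,\qquad U(0)=h,$$ is a map $U_h\in L^2([0,T],H^{a+1})$ with weak time derivative $U_h'\in L^2([0,T],H^{a-1})$ (taken in its time-continuous representative) such that $U_h(0)=h$ and, for almost every $t\in(0,T]$, $$\langle U_h'(t),v\rangle+\langle\nabla U_h(t),\nabla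 v\rangle-\langle V(t)U_h(t),v\rangle=0\qquad\text{for all }v\in H^{1-a}.$$ Let $t_{\min}>0$ and let $b>a$ be any real numbers. Then there is a constant $c=c(t_{\min},T,V,a,b,d)>0$ such that for every $h\in H^a$ and every such weak solution $U_h$, $$\sup_{t_{\min}\le t\le T}\|U_h(t)\|_{H^b}\le c\,\|h\|_{H^a}.$$ -/

import Mathlib

open MeasureTheory Set
open scoped ContDiff ENNReal

noncomputable section

namespace TorusPDE

/-- The space on which functions over the torus `[0,1]^d` (opposite points identified) live
as `ℤ^d`-periodic functions. -/
abbrev E (d : ℕ) : Type := EuclideanSpace ℝ (Fin d)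

/-- The lattice vector in `ℝ^d` with integer coordinates `k`. -/
def latticeVec {d : ℕ} (k : Fin d → ℤ) : E d := WithLp.toLp 2 (fun i => (k i : ℝ))

/-- The algebra of real-valued smooth functions on the torus, i.e. of smooth `ℤ^d`-periodic
functions on `ℝ^d`. -/
def SmoothFun (d : ℕ) : Subalgebra ℝ (E d → ℝ) where
  carrier := {f | ContDiff ℝ ∞ f ∧ ∀ (x : E d) (k : Fin d → ℤ), f (x + latticeVec k) = f x}
  mul_mem' := by
    rintro f g ⟨hf, hf'⟩ ⟨hg, hg'⟩
    exact ⟨hf.mul hg, fun x k => by simp [hf' x k, hg' x k]⟩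
  add_mem' := by
    rintro f g ⟨hf, hf'⟩ ⟨hg, hg'⟩
    exact ⟨hf.add hg, fun x k => by simp [hf' x k, hg' x k]⟩
  algebraMap_mem' := fun r => ⟨contDiff_const, fun _ _ => rfl⟩

/-- The partial derivative `∂_l v` of a smooth function on the torus. -/
def partialDeriv {d : ℕ} (l : Fin d) (v : SmoothFun d) : SmoothFun d :=
  ⟨fun x => fderiv ℝ (v : E d → ℝ) x (EuclideanSpace.single l (1 : ℝ)), by
    obtain ⟨f, hf, hf'⟩ := v
    refine ⟨(hf.fderiv_right (m := ∞) (by simp)).clm_apply contDiff_const, fun x k => ?_⟩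
    have h : (fun y => f (y + latticeVec k)) = f := funext fun y => hf' y k
    have h2 : fderiv ℝ f (x + latticeVec k) = fderiv ℝ f x := by
      rw [← fderiv_comp_add_right, h]
    simp [h2]⟩

/-- The periodic Laplacian `Δ v = ∑_l ∂_l ∂_l v` on smooth functions. -/
def laplacian {d : ℕ} (v : SmoothFun d) : SmoothFun d :=
  ∑ l : Fin d, partialDeriv l (partialDeriv l v)

/-- `CBound b v M`: all derivatives of `v` of order at most `b` are bounded by `M` on the torus,
i.e. the `C^b`-norm of `v`, in an equivalent maximum form, is at most `M`. -/
def CBound {d : ℕ} (b : ℕ) (v : SmoothFun d) (M : ℝ) : Prop :=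
  ∀ n ≤ b, ∀ x : E d, ‖iteratedFDeriv ℝ n (v : E d → ℝ) x‖ ≤ M

/-- Real periodic (Schwartz) distributions: linear functionals on the smooth functions on the torus
that are continuous for the `C^∞`-topology, i.e. bounded by a multiple of some `C^N`-norm. -/
structure PeriodicDistribution (d : ℕ) where
  toLin : SmoothFun d →ₗ[ℝ] ℝ
  continuous' : ∃ (N : ℕ) (K : ℝ), ∀ (v : SmoothFun d) (M : ℝ), CBound N v M → |toLin v| ≤ K * M

/-- `u v` is the action `⟨u, v⟩` of the distribution `u` on the smooth function `v`. -/
instance (d : ℕ) : CoeFun (PeriodicDistribution d) (fun _ => SmoothFun d → ℝ) :=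
  ⟨fun u => u.toLin⟩

/-- The phase `2π k · x`. -/
def phase {d : ℕ} (k : Fin d → ℤ) (x : E d) : ℝ := 2 * Real.pi * ∑ i, (k i : ℝ) * x i

theorem phase_contDiff {d : ℕ} (k : Fin d → ℤ) : ContDiff ℝ ∞ (phase k) := by
  unfold phase
  fun_prop

theorem phase_add {d : ℕ} (k m : Fin d → ℤ) (x : E d) :
    phase k (x + latticeVec m) = phase k x + ((∑ i, k i * m i : ℤ) : ℝ) * (2 * Real.pi) := by
  simp only [phase, latticeVec, PiLp.add_apply, mul_add, Finset.sum_add_distrib]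
  push_cast
  ring

/-- The smooth function `x ↦ cos (2π k · x)`. -/
def cosMode {d : ℕ} (k : Fin d → ℤ) : SmoothFun d :=
  ⟨fun x => Real.cos (phase k x), Real.contDiff_cos.comp (phase_contDiff k), fun x m => by
    simp only [phase_add, Real.cos_add_int_mul_two_pi]⟩

/-- The smooth function `x ↦ sin (2π k · x)`. -/
def sinMode {d : ℕ} (k : Fin d → ℤ) : SmoothFun d :=
  ⟨fun x => Real.sin (phase k x), Real.contDiff_sin.comp (phase_contDiff k), fun x m => by
    simp only [phase_add, Real.sin_add_int_mul_two_pi]⟩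

/-- The Fourier coefficient of `u`: the action of `u` on
`exp (- 2π i k · x) = cos (2π k · x) - i sin (2π k · x)`. -/
def distFourierCoeff {d : ℕ} (u : PeriodicDistribution d) (k : Fin d → ℤ) : ℂ :=
  (u (cosMode k) : ℂ) - Complex.I * (u (sinMode k) : ℂ)

/-- The eigenvalue `λ_k = 4 π² |k|²` of `-Δ` for the eigenfunction `exp (2π i k · x)`. -/
def eigenvalue {d : ℕ} (k : Fin d → ℤ) : ℝ := (2 * Real.pi) ^ 2 * ∑ i, (k i : ℝ) ^ 2

/-- The norm of the Sobolev space `H^s` of the torus, `s` any real number: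
`‖u‖² = ∑_k (1 + λ_k)^s |û(k)|²`, with value `∞` exactly if `u` is not in `H^s`. -/
def sobolevNorm {d : ℕ} (s : ℝ) (u : PeriodicDistribution d) : ℝ≥0∞ :=
  (∑' k : Fin d → ℤ,
    ENNReal.ofReal ((1 + eigenvalue k) ^ s * ‖distFourierCoeff u k‖ ^ 2)) ^ (1 / 2 : ℝ)

/-- The space `L²([0,T], H^s)`: measurable maps with square-integrable norm. Since `H^s` is a
separable Hilbert space in which the smooth functions are total in the dual, measurability is the
same as measurability of `t ↦ ⟨U t, v⟩` for all smooth `v`. -/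
def MemL2Sobolev {d : ℕ} (T s : ℝ) (U : ℝ → PeriodicDistribution d) : Prop :=
  (∀ v : SmoothFun d, AEMeasurable (fun t => U t v) (volume.restrict (Icc 0 T))) ∧
    ∫⁻ t in Icc 0 T, sobolevNorm s (U t) ^ 2 < ⊤

/-- `g` is the weak derivative of `f` on `[0,T]`, where `f` is the continuous representative of its
class: `g` is integrable and `f` is the primitive of `g` on `[0,T]`. -/
def IsWeakTimeDeriv (T : ℝ) (f g : ℝ → ℝ) : Prop :=
  IntegrableOn g (Icc 0 T) ∧ ∀ t ∈ Icc 0 T, f t = f 0 + ∫ s in (0 : ℝ)..t, g s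

/-- The space `C^{1,∞} = ⋂_b C¹([0,T], C^b)`: maps `V` that, for every `b`, are bounded on `[0,T]`
in `C^b` and weakly differentiable in time with a derivative that is essentially bounded in
`C^b`. -/
def MemCOneInfty {d : ℕ} (T : ℝ) (V : ℝ → SmoothFun d) : Prop :=
  ∃ dV : ℝ → SmoothFun d,
    (∀ x : E d, IsWeakTimeDeriv T (fun t => (V t : E d → ℝ) x) (fun t => (dV t : E d → ℝ) x)) ∧
    ∀ b : ℕ, ∃ M : ℝ, (∀ t ∈ Icc 0 T, CBound b (V t) M) ∧
      ∀ᵐ t ∂(volume.restrict (Icc 0 T)), CBound b (dV t) M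

/-- `U` is a weak solution on `[0,T]`, in `H^{a-1}`, of the Schrödinger equation
`∂U/∂t - ΔU - V U = 0` with `U 0 = h ∈ H^a`: `U ∈ L²([0,T], H^{a+1})` has a weak time derivative
`dU ∈ L²([0,T], H^{a-1})`, and for almost every `t` the equation holds tested against every smooth
function `v` (these are dense in `H^{1-a}`); here, by definition of the distributional derivative
and of the product of a distribution with a smooth function,
`⟨∇U, ∇v⟩ = - ⟨U, Δv⟩` and `⟨V U, v⟩ = ⟨U, V v⟩`. -/
structure IsWeakSolution {d : ℕ} (T a : ℝ) (V : ℝ → SmoothFun d) (h : PeriodicDistribution d)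
    (U : ℝ → PeriodicDistribution d) : Prop where
  initial_mem : sobolevNorm a h < ⊤
  initial : U 0 = h
  mem : MemL2Sobolev T (a + 1) U
  equation : ∃ dU : ℝ → PeriodicDistribution d,
    MemL2Sobolev T (a - 1) dU ∧
    (∀ v : SmoothFun d, IsWeakTimeDeriv T (fun t => U t v) (fun t => dU t v)) ∧
    ∀ᵐ t ∂(volume.restrict (Icc 0 T)), ∀ v : SmoothFun d,
      dU t v - U t (laplacian v) - U t (V t * v) = 0

end TorusPDE

end

open TorusPDE

noncomputable section

namespace TorusPDE

open UnitAddTorus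

variable {d : ℕ}

/-! Testing the equation with a real Fourier mode `e_k` (cosine or sine) turns it into the scalar
equation `p' + λ_k p = ⟨U, V e_k⟩` for `p = ⟨U, e_k⟩`. By variation of constants, `p(t)` is the
damped value `exp (-λ_k (t - t₀)) p(t₀)` plus a convolution of the forcing with the heat kernel of
that mode. Cauchy--Schwarz in time and the bound of `(1 + λ_k) ∫ exp (-2 λ_k (t - r)) dr` by `T + 1`
show that the convolution gains one factor `1 + λ_k` in the squared norm, that is, one derivative
(`IsWeakTimeDeriv.weight_mul_sq_le`).

Summed over `k` with weights `(1 + λ_k)^s`, the forcing is controlled by the `H^s` norm of `U`,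
because multiplication by `V` is bounded on every `H^s`, uniformly in time
(`exists_tsum_mul_mode_le`): the Fourier coefficients of `V` decay rapidly, so Peetre's inequality
and Schur's test apply, also for negative `s`. The result is `exists_energy_add_one_le`.

It is used in two ways. With `t₀ = 0` and `s = a - 1` the initial term costs no regularity of the
data, and Grönwall's inequality bounds `U` in `H^a` on all of `[0,T]`. With `t₀ > 0` at a positive
distance from `t`, the damping makes `(1 + λ_k) exp (-2 λ_k (t - t₀))` bounded in `k`, so an `H^s`
bound on `[t₁/2, T]` becomes an `H^(s+1)` bound on `[t₁, T]`. Finitely many such steps reach an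
exponent of at least `b`. -/

/-- The weight `1 + λ_k` of the Sobolev norms. -/
def weight (k : Fin d → ℤ) : ℝ := 1 + eigenvalue k

/-! ### Smooth periodic functions on the torus and their Fourier coefficients -/

/-- The covering map from `ℝ^d` to the torus. -/
def toTorus (x : E d) : UnitAddTorus (Fin d) := fun i => (x i : UnitAddCircle)

/-- Serves twice: periodic functions descend to the torus, and identities on the torus can be
checked at points `toTorus x`. -/
theorem isOpenQuotientMap_toTorus : IsOpenQuotientMap (toTorus (d := d)) := by
  have h1 : IsOpenQuotientMap (Pi.map fun (_ : Fin d) (x : ℝ) => (x : UnitAddCircle)) :=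
    IsOpenQuotientMap.piMap fun _ => QuotientAddGroup.isOpenQuotientMap_mk
  exact h1.comp (PiLp.homeomorph 2 (fun _ : Fin d => ℝ)).isOpenQuotientMap

theorem toTorus_add (x y : E d) : toTorus (x + y) = toTorus x + toTorus y := by
  ext i
  simp [toTorus]

theorem exists_eq_add_latticeVec {x y : E d} (h : toTorus x = toTorus y) :
    ∃ k : Fin d → ℤ, y = x + latticeVec k := by
  have : ∀ i, ∃ n : ℤ, y i = x i + n := fun i => by
    have hi := congrFun h i
    obtain ⟨n, hn⟩ := (QuotientAddGroup.eq.trans AddSubgroup.mem_zmultiples_iff).1 hi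
    exact ⟨n, by simp at hn; linarith⟩
  choose k hk using this
  exact ⟨k, by ext i; simp [latticeVec, hk]⟩

theorem contDiff_smoothFun (v : SmoothFun d) : ContDiff ℝ ∞ (v : E d → ℝ) := v.2.1

theorem factorsThrough_smoothFun (v : SmoothFun d) :
    Function.FactorsThrough (fun x => ((v : E d → ℝ) x : ℂ)) (toTorus (d := d)) := by
  intro x y h
  obtain ⟨k, rfl⟩ := exists_eq_add_latticeVec h
  simp only [v.2.2 x k]

/-- A smooth periodic function as a continuous complex-valued function on the torus. -/
def torusLift (v : SmoothFun d) : C(UnitAddTorus (Fin d), ℂ) :=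
  Topology.IsQuotientMap.lift (f := ⟨toTorus, isOpenQuotientMap_toTorus.continuous⟩)
    isOpenQuotientMap_toTorus.isQuotientMap
    ⟨fun x => ((v : E d → ℝ) x : ℂ), Complex.continuous_ofReal.comp (contDiff_smoothFun v).continuous⟩
    (factorsThrough_smoothFun v)

@[simp]
theorem torusLift_toTorus (v : SmoothFun d) (x : E d) :
    torusLift v (toTorus x) = ((v : E d → ℝ) x : ℂ) :=
  congrArg (fun g : C(E d, ℂ) => g x) (Topology.IsQuotientMap.lift_comp
    (f := ⟨toTorus, isOpenQuotientMap_toTorus.continuous⟩)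
    isOpenQuotientMap_toTorus.isQuotientMap
    ⟨fun x => ((v : E d → ℝ) x : ℂ), Complex.continuous_ofReal.comp (contDiff_smoothFun v).continuous⟩
    (factorsThrough_smoothFun v))

theorem mFourier_toTorus (n : Fin d → ℤ) (x : E d) :
    mFourier n (toTorus x) = Complex.exp (phase n x * Complex.I) := by
  simp only [mFourier, toTorus, ContinuousMap.coe_mk, fourier_coe_apply, phase]
  rw [← Complex.exp_sum]
  congr 1
  push_cast
  simp only [Finset.mul_sum, Finset.sum_mul]
  refine Finset.sum_congr rfl fun i _ => ?_
  ring

/-- The Haar probability measure of the torus. -/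
def torusMeasure (d : ℕ) : Measure (UnitAddTorus (Fin d)) :=
  Measure.pi fun _ => AddCircle.haarAddCircle

instance : IsProbabilityMeasure (torusMeasure d) := by
  unfold torusMeasure; infer_instance

instance : (torusMeasure d).IsAddLeftInvariant := by
  unfold torusMeasure; infer_instance

instance : (torusMeasure d).IsAddRightInvariant := by
  unfold torusMeasure; infer_instance

/-- The Fourier coefficient of a smooth periodic function. -/
def coeff (v : SmoothFun d) (n : Fin d → ℤ) : ℂ := mFourierCoeff (torusLift v) n

theorem coeff_eq (v : SmoothFun d) (n : Fin d → ℤ) :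
    coeff v n = ∫ y, mFourier (-n) y * torusLift v y ∂torusMeasure d := rfl

theorem ContinuousMap.integrable_torus (f : C(UnitAddTorus (Fin d), ℂ)) :
    Integrable f (torusMeasure d) :=
  f.continuous.integrable_of_hasCompactSupport (HasCompactSupport.of_compactSpace f)

theorem norm_coeff_le {v : SmoothFun d} {M : ℝ} (hv : CBound 0 v M) (n : Fin d → ℤ) :
    ‖coeff v n‖ ≤ M := by
  rw [coeff_eq]
  refine (norm_integral_le_of_norm_le_const (C := M) (ae_of_all _ fun y => ?_)).trans_eq (by simp)
  obtain ⟨x, rfl⟩ := isOpenQuotientMap_toTorus.surjective y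
  have := hv 0 le_rfl x
  rw [norm_mul, mFourier_toTorus, Complex.norm_exp_ofReal_mul_I, one_mul]
  simpa using this

theorem coeff_add (v w : SmoothFun d) (n : Fin d → ℤ) :
    coeff (v + w) n = coeff v n + coeff w n := by
  simp only [coeff_eq]
  rw [← integral_add]
  · refine integral_congr_ae (ae_of_all _ fun y => ?_)
    obtain ⟨x, rfl⟩ := isOpenQuotientMap_toTorus.surjective y
    simp [mul_add]
  · exact ContinuousMap.integrable_torus (mFourier (-n) * torusLift v)
  · exact ContinuousMap.integrable_torus (mFourier (-n) * torusLift w)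

theorem coeff_smul (c : ℝ) (v : SmoothFun d) (n : Fin d → ℤ) :
    coeff (c • v) n = c * coeff v n := by
  simp only [coeff_eq]
  rw [← integral_const_mul]
  refine integral_congr_ae (ae_of_all _ fun y => ?_)
  obtain ⟨x, rfl⟩ := isOpenQuotientMap_toTorus.surjective y
  simp
  ring

/-- The Fourier coefficient as a linear map. -/
def coeffLin (n : Fin d → ℤ) : SmoothFun d →ₗ[ℝ] ℂ where
  toFun v := coeff v n
  map_add' v w := coeff_add v w n
  map_smul' c v := by simp [coeff_smul]

theorem phase_single (n : Fin d → ℤ) (l : Fin d) (s : ℝ) :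
    phase n (s • EuclideanSpace.single l (1 : ℝ)) = 2 * Real.pi * n l * s := by
  simp only [phase, PiLp.smul_apply, PiLp.single_apply]
  simp [mul_assoc]

theorem hasDerivAt_smooth (v : SmoothFun d) (l : Fin d) (x : E d) (s : ℝ) :
    HasDerivAt (fun s : ℝ => (v : E d → ℝ) (x + s • EuclideanSpace.single l (1 : ℝ)))
      ((partialDeriv l v : E d → ℝ) (x + s • EuclideanSpace.single l (1 : ℝ))) s := by
  have h1 := ((contDiff_smoothFun v).differentiable (by simp)
    (x + s • EuclideanSpace.single l (1 : ℝ))).hasFDerivAt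
  have h2 : HasDerivAt (fun s : ℝ => x + s • EuclideanSpace.single l (1 : ℝ))
      (EuclideanSpace.single l (1 : ℝ)) s := by
    simpa using ((hasDerivAt_id s).smul_const (EuclideanSpace.single l (1 : ℝ))).const_add x
  exact h1.comp_hasDerivAt s h2

/-- Instead of integrating by parts, translate `v` by `s` in direction `l`. Invariance of the Haar
measure multiplies the coefficient by `exp (2π i n_l s)`; differentiating under the integral at `s =
0` gives the claim. -/
theorem coeff_partialDeriv (l : Fin d) (v : SmoothFun d) (n : Fin d → ℤ) :
    coeff (partialDeriv l v) n = (2 * Real.pi * n l * Complex.I) * coeff v n := by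
  set e : ℝ → UnitAddTorus (Fin d) := fun s => toTorus (s • EuclideanSpace.single l (1 : ℝ))
  have hG : ∀ s : ℝ, ∫ y, mFourier (-n) y * torusLift v (y + e s) ∂torusMeasure d
      = Complex.exp ((2 * Real.pi * n l * Complex.I) * s) * coeff v n := fun s => by
    rw [coeff_eq, ← integral_add_right_eq_self (fun y => mFourier (-n) y * torusLift v y) (e s),
      ← integral_const_mul]
    refine integral_congr_ae (ae_of_all _ fun y => ?_)
    obtain ⟨x, rfl⟩ := isOpenQuotientMap_toTorus.surjective y
    simp only [e, ← toTorus_add, mFourier_toTorus, torusLift_toTorus, ← mul_assoc, ← Complex.exp_add]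
    congr 2
    have : phase (-n) (x + s • EuclideanSpace.single l (1 : ℝ)) =
        phase (-n) x - 2 * Real.pi * n l * s := by
      have h := phase_single (-n) l s
      simp only [phase, PiLp.add_apply, mul_add, Finset.sum_add_distrib] at h ⊢
      rw [h]
      simp
      ring
    rw [this]
    push_cast
    ring
  have h1 : HasDerivAt (fun s : ℝ => ∫ y, mFourier (-n) y * torusLift v (y + e s) ∂torusMeasure d)
      (∫ y, mFourier (-n) y * torusLift (partialDeriv l v) (y + e 0) ∂torusMeasure d) 0 := by
    have hint : ∀ (w : SmoothFun d) (s : ℝ), Integrable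
        (fun y => mFourier (-n) y * torusLift w (y + e s)) (torusMeasure d) := fun w s =>
      ContinuousMap.integrable_torus
        (mFourier (-n) * (torusLift w).comp ⟨fun y => y + e s, by fun_prop⟩)
    refine (hasDerivAt_integral_of_dominated_loc_of_deriv_le (s := univ)
      (bound := fun _ => ‖torusLift (partialDeriv l v)‖)
      (F' := fun s y => mFourier (-n) y * torusLift (partialDeriv l v) (y + e s))
      Filter.univ_mem (Filter.Eventually.of_forall fun s => (hint v s).1) (hint v 0)
      (hint _ 0).1 (ae_of_all _ fun y s _ => ?_) (integrable_const _)
      (ae_of_all _ fun y s _ => ?_)).2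
    · obtain ⟨x, rfl⟩ := isOpenQuotientMap_toTorus.surjective y
      rw [norm_mul, mFourier_toTorus, Complex.norm_exp_ofReal_mul_I, one_mul]
      exact ContinuousMap.norm_coe_le_norm _ _
    · obtain ⟨x, rfl⟩ := isOpenQuotientMap_toTorus.surjective y
      simp only [e, ← toTorus_add, torusLift_toTorus]
      exact (hasDerivAt_smooth v l x s).ofReal_comp.const_mul _
  have h2 : HasDerivAt (fun s : ℝ => Complex.exp ((2 * Real.pi * n l * Complex.I) * s) * coeff v n)
      ((2 * Real.pi * n l * Complex.I) * coeff v n) 0 := by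
    have h3 : HasDerivAt (fun s : ℂ => Complex.exp ((2 * Real.pi * n l * Complex.I) * s))
        (Complex.exp ((2 * Real.pi * n l * Complex.I) * (0 : ℝ)) * (2 * Real.pi * n l * Complex.I))
        ((0 : ℝ) : ℂ) := by
      simpa using ((hasDerivAt_id ((0 : ℝ) : ℂ)).const_mul (2 * Real.pi * n l * Complex.I)).cexp
    simpa using h3.comp_ofReal.mul_const (coeff v n)
  simp only [hG] at h1
  have h4 := h1.unique h2
  rw [← h4, coeff_eq]
  have : e 0 = 0 := by
    simp only [e, zero_smul]
    ext i
    simp [toTorus]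
  simp [this]

theorem coeff_laplacian (v : SmoothFun d) (n : Fin d → ℤ) :
    coeff (laplacian v) n = -(eigenvalue n : ℂ) * coeff v n := by
  have : coeff (laplacian v) n = ∑ l, coeff (partialDeriv l (partialDeriv l v)) n :=
    map_sum (coeffLin n) _ _
  rw [this]
  simp only [coeff_partialDeriv, eigenvalue]
  push_cast
  rw [Finset.mul_sum, ← Finset.sum_neg_distrib, Finset.sum_mul]
  refine Finset.sum_congr rfl fun i _ => ?_
  linear_combination (2 * Real.pi * (n i : ℂ)) ^ 2 * coeff v n * Complex.I_sq

/-! ### `C^b` bounds and decay of Fourier coefficients -/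

theorem CBound.nonneg {b : ℕ} {v : SmoothFun d} {M : ℝ} (hv : CBound b v M) : 0 ≤ M :=
  (norm_nonneg _).trans (hv 0 (Nat.zero_le _) 0)

theorem CBound.partialDeriv {b : ℕ} {v : SmoothFun d} {M : ℝ} (hv : CBound (b + 1) v M)
    (l : Fin d) : CBound b (partialDeriv l v) M := by
  intro n hn x
  have h1 : ContDiff ℝ n (fderiv ℝ (v : E d → ℝ)) :=
    (contDiff_smoothFun v).fderiv_right (by exact_mod_cast le_top)
  refine (norm_iteratedFDeriv_clm_apply_const (c := EuclideanSpace.single l (1 : ℝ))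
    h1.contDiffAt le_rfl).trans ?_
  rw [norm_iteratedFDeriv_fderiv]
  simpa using hv (n + 1) (by omega) x

theorem CBound.add {b : ℕ} {v w : SmoothFun d} {M K : ℝ} (hv : CBound b v M) (hw : CBound b w K) :
    CBound b (v + w) (M + K) := by
  intro n hn x
  have := iteratedFDeriv_add_apply (𝕜 := ℝ) (x := x) (i := n)
    ((contDiff_smoothFun v).of_le (by exact_mod_cast le_top)).contDiffAt
    ((contDiff_smoothFun w).of_le (by exact_mod_cast le_top)).contDiffAt
  have h2 : ((v + w : SmoothFun d) : E d → ℝ) = (v : E d → ℝ) + (w : E d → ℝ) := rfl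
  rw [h2, this]
  exact (norm_add_le _ _).trans (add_le_add (hv n hn x) (hw n hn x))

theorem CBound.smul {b : ℕ} {v : SmoothFun d} {M : ℝ} (hv : CBound b v M) (c : ℝ) :
    CBound b (c • v) (|c| * M) := by
  intro n hn x
  have := iteratedFDeriv_const_smul_apply (𝕜 := ℝ) (x := x) (i := n) (a := c)
    ((contDiff_smoothFun v).of_le (by exact_mod_cast le_top)).contDiffAt
  have h2 : ((c • v : SmoothFun d) : E d → ℝ) = c • (v : E d → ℝ) := rfl
  rw [h2, this, norm_smul]
  exact mul_le_mul_of_nonneg_left (hv n hn x) (abs_nonneg c)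

theorem CBound.zero (b : ℕ) : CBound b (0 : SmoothFun d) 0 := by
  intro n _ x
  simp

theorem CBound.sum {ι : Type*} {b : ℕ} (s : Finset ι) {v : ι → SmoothFun d} {M : ι → ℝ}
    (hv : ∀ i ∈ s, CBound b (v i) (M i)) : CBound b (∑ i ∈ s, v i) (∑ i ∈ s, M i) := by
  classical
  induction s using Finset.induction_on with
  | empty => simpa using CBound.zero b
  | insert i s hi ih =>
    rw [Finset.sum_insert hi, Finset.sum_insert hi]
    exact (hv i (by simp)).add (ih fun j hj => hv j (by simp [hj]))

theorem CBound.mono {b b' : ℕ} {v : SmoothFun d} {M M' : ℝ} (hv : CBound b v M) (hb : b' ≤ b)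
    (hM : M ≤ M') : CBound b' v M' :=
  fun n hn x => (hv n (hn.trans hb) x).trans hM

theorem CBound.laplacian {b : ℕ} {v : SmoothFun d} {M : ℝ} (hv : CBound (b + 2) v M) :
    CBound b (laplacian v) (d * M) := by
  have := CBound.sum Finset.univ (v := fun l => TorusPDE.partialDeriv l (TorusPDE.partialDeriv l v))
    (M := fun _ => M) (b := b) fun l _ => (CBound.partialDeriv hv l).partialDeriv l
  simpa [TorusPDE.laplacian] using this

/-- Each application of `1 - Δ` multiplies the `n`-th coefficient by `weight n`, uses up two
derivatives and enlarges the bound by the factor `1 + d`. -/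
theorem weight_pow_mul_norm_coeff_le (N : ℕ) {v : SmoothFun d} {M : ℝ} (hv : CBound (2 * N) v M)
    (n : Fin d → ℤ) : weight n ^ N * ‖coeff v n‖ ≤ (1 + d) ^ N * M := by
  induction N generalizing v M with
  | zero => simpa using norm_coeff_le hv n
  | succ N ih =>
    have h1 : CBound (2 * N) (v + (-1 : ℝ) • laplacian v) (M + |(-1 : ℝ)| * (d * M)) :=
      (hv.mono (by omega) le_rfl).add (CBound.smul (CBound.laplacian hv) _)
    have h2 := ih h1
    have h3 : coeff (v + (-1 : ℝ) • laplacian v) n = (weight n : ℂ) * coeff v n := by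
      rw [coeff_add, coeff_smul, coeff_laplacian, weight]
      push_cast
      ring
    have hw : 0 ≤ weight n := by unfold weight eigenvalue; positivity
    rw [h3, norm_mul, Complex.norm_real, Real.norm_of_nonneg hw] at h2
    calc _ = weight n ^ N * (weight n * ‖coeff v n‖) := by ring
      _ ≤ _ := h2
      _ = _ := by rw [abs_neg, abs_one]; ring

/-! ### Products with Fourier modes -/

theorem torusLift_cosMode (k : Fin d → ℤ) (y : UnitAddTorus (Fin d)) :
    torusLift (cosMode k) y = (mFourier k y + mFourier (-k) y) / 2 := by
  obtain ⟨x, rfl⟩ := isOpenQuotientMap_toTorus.surjective y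
  have : phase (-k) x = - phase k x := by simp [phase]
  rw [torusLift_toTorus, mFourier_toTorus, mFourier_toTorus, this]
  simp [cosMode, Complex.cos]

theorem torusLift_sinMode (k : Fin d → ℤ) (y : UnitAddTorus (Fin d)) :
    torusLift (sinMode k) y = (mFourier (-k) y - mFourier k y) * Complex.I / 2 := by
  obtain ⟨x, rfl⟩ := isOpenQuotientMap_toTorus.surjective y
  have : phase (-k) x = - phase k x := by simp [phase]
  rw [torusLift_toTorus, mFourier_toTorus, mFourier_toTorus, this]
  simp [sinMode, Complex.sin]

theorem torusLift_mul (v w : SmoothFun d) (y : UnitAddTorus (Fin d)) :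
    torusLift (v * w) y = torusLift v y * torusLift w y := by
  obtain ⟨x, rfl⟩ := isOpenQuotientMap_toTorus.surjective y
  simp

theorem coeff_mul_cosMode (v : SmoothFun d) (k n : Fin d → ℤ) :
    coeff (v * cosMode k) n = (coeff v (n - k) + coeff v (n + k)) / 2 := by
  simp only [coeff_eq]
  rw [← integral_add, ← integral_div]
  · refine integral_congr_ae (ae_of_all _ fun y => ?_)
    simp only [torusLift_mul, torusLift_cosMode]
    rw [neg_sub, neg_add, sub_eq_neg_add, mFourier_add, mFourier_add]
    ring
  · exact ContinuousMap.integrable_torus (mFourier (-(n - k)) * torusLift v)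
  · exact ContinuousMap.integrable_torus (mFourier (-(n + k)) * torusLift v)

theorem coeff_mul_sinMode (v : SmoothFun d) (k n : Fin d → ℤ) :
    coeff (v * sinMode k) n = (coeff v (n + k) - coeff v (n - k)) * Complex.I / 2 := by
  simp only [coeff_eq]
  rw [← integral_sub, ← integral_mul_const, ← integral_div]
  · refine integral_congr_ae (ae_of_all _ fun y => ?_)
    simp only [torusLift_mul, torusLift_sinMode]
    rw [neg_sub, neg_add, sub_eq_neg_add k n, mFourier_add, mFourier_add]
    ring
  · exact ContinuousMap.integrable_torus (mFourier (-(n + k)) * torusLift v)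
  · exact ContinuousMap.integrable_torus (mFourier (-(n - k)) * torusLift v)

theorem norm_coeff_mul_cosMode_le (v : SmoothFun d) (k n : Fin d → ℤ) :
    ‖coeff (v * cosMode k) n‖ ≤ ‖coeff v (n - k)‖ + ‖coeff v (n + k)‖ := by
  rw [coeff_mul_cosMode, norm_div, Complex.norm_ofNat]
  linarith [norm_add_le (coeff v (n - k)) (coeff v (n + k)), norm_nonneg (coeff v (n - k)),
    norm_nonneg (coeff v (n + k))]

theorem norm_coeff_mul_sinMode_le (v : SmoothFun d) (k n : Fin d → ℤ) :
    ‖coeff (v * sinMode k) n‖ ≤ ‖coeff v (n - k)‖ + ‖coeff v (n + k)‖ := by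
  rw [coeff_mul_sinMode, norm_div, Complex.norm_ofNat, norm_mul, Complex.norm_I, mul_one]
  linarith [norm_sub_le (coeff v (n + k)) (coeff v (n - k)), norm_nonneg (coeff v (n - k)),
    norm_nonneg (coeff v (n + k))]

/-! ### Sobolev weights: Peetre's inequality and summability -/

theorem eigenvalue_nonneg (k : Fin d → ℤ) : 0 ≤ eigenvalue k := by
  unfold eigenvalue; positivity

theorem one_le_weight (k : Fin d → ℤ) : 1 ≤ weight k := by
  unfold weight
  linarith [eigenvalue_nonneg k]

theorem weight_pos (k : Fin d → ℤ) : 0 < weight k := zero_lt_one.trans_le (one_le_weight k)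

theorem weight_neg (k : Fin d → ℤ) : weight (-k) = weight k := by
  simp [weight, eigenvalue]

/-- Peetre's inequality. -/
theorem weight_add_le (j k : Fin d → ℤ) : weight (j + k) ≤ 2 * (weight j * weight k) := by
  have h : eigenvalue (j + k) ≤ 2 * eigenvalue j + 2 * eigenvalue k := by
    unfold eigenvalue
    have : ∑ i, (((j + k) i : ℤ) : ℝ) ^ 2 ≤ 2 * ∑ i, (j i : ℝ) ^ 2 + 2 * ∑ i, (k i : ℝ) ^ 2 := by
      rw [Finset.mul_sum, Finset.mul_sum, ← Finset.sum_add_distrib]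
      refine Finset.sum_le_sum fun i _ => ?_
      push_cast [Pi.add_apply]
      nlinarith [sq_nonneg ((j i : ℝ) - k i)]
    nlinarith [mul_le_mul_of_nonneg_left this (sq_nonneg (2 * Real.pi))]
  have := mul_nonneg (eigenvalue_nonneg j) (eigenvalue_nonneg k)
  simp only [weight]
  nlinarith

/-- Peetre's inequality with real exponents. -/
theorem weight_rpow_le (s : ℝ) (k n : Fin d → ℤ) :
    weight k ^ s ≤ 2 ^ |s| * weight n ^ s * weight (n - k) ^ |s| := by
  rcases le_or_gt 0 s with hs | hs
  · rw [abs_of_nonneg hs]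
    have h : weight k ≤ 2 * weight n * weight (n - k) := by
      have := weight_add_le n (-(n - k))
      rw [weight_neg] at this
      simpa [mul_assoc] using this
    rw [← Real.mul_rpow zero_le_two (weight_pos n).le,
      ← Real.mul_rpow (mul_nonneg zero_le_two (weight_pos n).le) (weight_pos _).le]
    exact Real.rpow_le_rpow (weight_pos k).le h hs
  · rw [abs_of_neg hs]
    have h : weight n ≤ 2 * weight k * weight (n - k) := by
      have := weight_add_le k (n - k)
      simpa [mul_assoc] using this
    have h2 := Real.rpow_le_rpow (weight_pos n).le h (neg_pos.2 hs).le
    rw [Real.mul_rpow (mul_nonneg zero_le_two (weight_pos k).le) (weight_pos _).le,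
      Real.mul_rpow zero_le_two (weight_pos k).le] at h2
    have hn : weight n ^ s * weight n ^ (-s) = 1 := by
      rw [← Real.rpow_add (weight_pos n)]; simp
    have hk : weight k ^ s * weight k ^ (-s) = 1 := by
      rw [← Real.rpow_add (weight_pos k)]; simp
    calc weight k ^ s = weight k ^ s * (weight n ^ s * weight n ^ (-s)) := by rw [hn, mul_one]
      _ ≤ weight k ^ s * (weight n ^ s *
          (2 ^ (-s) * weight k ^ (-s) * weight (n - k) ^ (-s))) := by
        have := (Real.rpow_pos_of_pos (weight_pos k) s).le
        have := (Real.rpow_pos_of_pos (weight_pos n) s).le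
        gcongr
      _ = (weight k ^ s * weight k ^ (-s)) *
          (2 ^ (-s) * weight n ^ s * weight (n - k) ^ (-s)) := by ring
      _ = _ := by rw [hk, one_mul]

theorem tsum_pi_prod (g : ℤ → ℝ≥0∞) (d : ℕ) :
    ∑' n : Fin d → ℤ, ∏ i, g (n i) = (∑' m, g m) ^ d := by
  induction d with
  | zero => simp
  | succ d ih =>
    rw [← (Fin.consEquiv fun _ : Fin (d + 1) => ℤ).tsum_eq, ENNReal.tsum_prod']
    simp only [Fin.consEquiv_apply, Fin.prod_univ_succ, Fin.cons_zero, Fin.cons_succ,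
      ENNReal.tsum_mul_left, ih, ENNReal.tsum_mul_right]
    rw [pow_succ, mul_comm]

/-- Since `weight n ≥ 1 + n_i ^ 2` for each of the `d` coordinates, `weight n ^ d` dominates the
product of these factors, and the sum splits into a `d`-th power of a convergent one-dimensional
series. -/
theorem tsum_inv_weight_pow_ne_top (d : ℕ) :
    ∑' n : Fin d → ℤ, ENNReal.ofReal ((weight n ^ d)⁻¹) ≠ ⊤ := by
  have h1 : ∀ n : Fin d → ℤ, ENNReal.ofReal ((weight n ^ d)⁻¹) ≤
      ∏ i, ENNReal.ofReal ((1 + (n i : ℝ) ^ 2)⁻¹) := fun n => by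
    rw [← ENNReal.ofReal_prod_of_nonneg fun i _ => by positivity]
    refine ENNReal.ofReal_le_ofReal ?_
    rw [Finset.prod_inv_distrib]
    refine inv_anti₀ (Finset.prod_pos fun i _ => by positivity) ?_
    calc ∏ i, (1 + (n i : ℝ) ^ 2) ≤ ∏ _i : Fin d, weight n := by
          refine Finset.prod_le_prod (fun i _ => by positivity) fun i _ => ?_
          have h2 : (n i : ℝ) ^ 2 ≤ ∑ j, (n j : ℝ) ^ 2 :=
            Finset.single_le_sum (f := fun j => (n j : ℝ) ^ 2) (fun j _ => sq_nonneg _)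
              (Finset.mem_univ i)
          have h3 : 1 ≤ (2 * Real.pi) ^ 2 := by nlinarith [Real.pi_gt_three]
          unfold weight eigenvalue
          nlinarith [sq_nonneg (n i : ℝ)]
      _ = weight n ^ d := by simp
  refine ne_top_of_le_ne_top ?_ (ENNReal.tsum_le_tsum h1)
  rw [tsum_pi_prod (fun m => ENNReal.ofReal ((1 + (m : ℝ) ^ 2)⁻¹))]
  refine ENNReal.pow_ne_top ?_
  have hs : Summable fun m : ℤ => (1 + (m : ℝ) ^ 2)⁻¹ := by
    refine Summable.of_norm_bounded_eventually
      (Real.summable_one_div_int_pow.2 one_lt_two) ?_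
    -- The comparison with `1 / m ^ 2` fails only at `m = 0`, where the quotient is `0` by
    -- convention.
    rw [Filter.eventually_cofinite]
    refine (Set.finite_singleton (0 : ℤ)).subset fun m hm => ?_
    by_contra h
    refine hm ?_
    have hm1 : (m : ℝ) ≠ 0 := by exact_mod_cast h
    have hm0 : (0 : ℝ) < (m : ℝ) ^ 2 := by positivity
    rw [Real.norm_of_nonneg (by positivity), one_div]
    exact inv_anti₀ hm0 (by linarith)
  exact hs.tsum_ofReal_ne_top

theorem summable_inv_weight_pow (d : ℕ) : Summable fun n : Fin d → ℤ => (weight n ^ d)⁻¹ := by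
  have := ENNReal.summable_toReal (tsum_inv_weight_pow_ne_top d)
  refine this.congr fun n => ENNReal.toReal_ofReal ?_
  have := weight_pos n
  positivity

theorem norm_coeff_le_weight (N : ℕ) {v : SmoothFun d} {M : ℝ} (hv : CBound (2 * N) v M)
    (n : Fin d → ℤ) : ‖coeff v n‖ ≤ (1 + d) ^ N * M * (weight n ^ N)⁻¹ := by
  rw [← div_eq_mul_inv, le_div_iff₀ (pow_pos (weight_pos n) N), mul_comm]
  exact weight_pow_mul_norm_coeff_le N hv n

theorem summable_weight_pow_mul_norm_coeff {v : SmoothFun d} (hv : ∀ b, ∃ M, CBound b v M)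
    (N : ℕ) : Summable fun n => weight n ^ N * ‖coeff v n‖ := by
  obtain ⟨M, hM⟩ := hv (2 * (N + d))
  refine Summable.of_nonneg_of_le (fun n => by have := weight_pos n; positivity) (fun n => ?_)
    ((summable_inv_weight_pow d).mul_left ((1 + d) ^ (N + d) * M))
  have h := weight_pow_mul_norm_coeff_le (N + d) hM n
  rw [← div_eq_mul_inv, le_div_iff₀ (pow_pos (weight_pos n) d)]
  calc _ = weight n ^ (N + d) * ‖coeff v n‖ := by ring
    _ ≤ _ := h

/-! ### Pairing a distribution with a Fourier series -/

/-- A distribution is bounded by a single `C^N` norm, and the tails of the series tend to zero in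
that norm, since derivatives up to order `N` may be taken termwise. -/
theorem PeriodicDistribution.hasSum (u : PeriodicDistribution d) {ι : Type*}
    {f : ι → SmoothFun d} {φ : SmoothFun d}
    (hf : ∀ x : E d, HasSum (fun i => (f i : E d → ℝ) x) ((φ : E d → ℝ) x))
    (hb : ∀ N : ℕ, ∃ v : ι → ℝ, Summable v ∧ ∀ i, CBound N (f i) (v i)) :
    HasSum (fun i => u (f i)) (u φ) := by
  obtain ⟨N, K, hu⟩ := u.continuous'
  obtain ⟨v, hv, hfv⟩ := hb N
  have htail : ∀ F : Finset ι,
      CBound N (φ - ∑ i ∈ F, f i) (∑' i : {i // i ∉ F}, v i) := by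
    intro F n hn x
    have hsub : Summable fun i : {i // i ∉ F} => v i := hv.subtype _
    have h1 : ((φ - ∑ i ∈ F, f i : SmoothFun d) : E d → ℝ) =
        fun y => ∑' i : {i // i ∉ F}, (f i : E d → ℝ) y := by
      funext y
      have h2 := (hf y).summable.sum_add_tsum_subtype_compl F
      rw [(hf y).tsum_eq] at h2
      simp only [AddSubgroupClass.coe_sub, AddSubmonoidClass.coe_finsetSum, Pi.sub_apply,
        Finset.sum_apply]
      linarith
    have hg : ∀ i : {i // i ∉ F}, ContDiff ℝ (N : ℕ∞) (f i : E d → ℝ) := fun i =>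
      (contDiff_smoothFun (f i.1)).of_le (by exact_mod_cast le_top)
    have hgb : ∀ (k : ℕ) (i : {i // i ∉ F}) (x : E d), (k : ℕ∞) ≤ (N : ℕ∞) →
        ‖iteratedFDeriv ℝ k (f i : E d → ℝ) x‖ ≤ v i := fun k i x hk =>
      hfv i.1 k (Nat.cast_le.1 hk) x
    rw [h1, iteratedFDeriv_tsum_apply (f := fun i : {i // i ∉ F} => (f i : E d → ℝ))
      (v := fun _ (i : {i // i ∉ F}) => v i) hg (fun _ _ => hsub) hgb
      (Nat.cast_le.2 hn) x]
    exact tsum_of_norm_bounded hsub.hasSum fun i => hfv i.1 n hn x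
  rw [HasSum, SummationFilter.unconditional_filter, tendsto_iff_norm_sub_tendsto_zero]
  have hlim : Filter.Tendsto (fun F : Finset ι => K * ∑' i : {i // i ∉ F}, v i) Filter.atTop
      (nhds 0) := by
    simpa using (tendsto_tsum_compl_atTop_zero v).const_mul K
  refine squeeze_zero (fun _ => norm_nonneg _) (fun F => ?_) hlim
  rw [norm_sub_rev, ← map_sum, ← map_sub]
  exact hu _ _ (htail F)

/-- The linear form `x ↦ 2π k · x`. -/
def phaseCLM (k : Fin d → ℤ) : E d →L[ℝ] ℝ := innerSL ℝ ((2 * Real.pi) • latticeVec k)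

theorem phaseCLM_apply (k : Fin d → ℤ) (x : E d) : phaseCLM k x = phase k x := by
  simp only [phaseCLM, innerSL_apply_apply, inner_smul_left, phase, PiLp.inner_apply, latticeVec]
  simp [mul_comm]

theorem norm_phaseCLM_le (k : Fin d → ℤ) : ‖phaseCLM k‖ ≤ weight k := by
  have h : ‖phaseCLM k‖ ^ 2 = eigenvalue k := by
    rw [phaseCLM, innerSL_apply_norm, norm_smul, mul_pow, EuclideanSpace.norm_sq_eq]
    simp [latticeVec, eigenvalue, abs_of_pos Real.pi_pos]
  have := eigenvalue_nonneg k
  unfold weight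
  nlinarith [sq_nonneg (‖phaseCLM k‖ - 1)]

/-- Each derivative of `f (2π k · x)` brings out one factor of norm at most `weight k`. This crude
polynomial growth suffices against rapidly decaying coefficients. -/
theorem cbound_comp_phase (N : ℕ) (k : Fin d → ℤ) {f : ℝ → ℝ} (hf : ContDiff ℝ ∞ f)
    (hf1 : ∀ n x, |iteratedDeriv n f x| ≤ 1) (v : SmoothFun d)
    (hv : ∀ x, (v : E d → ℝ) x = f (phase k x)) : CBound N v (weight k ^ N) := by
  intro n hn x
  have h1 : (v : E d → ℝ) = f ∘ phaseCLM k := by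
    funext x
    simp [hv, phaseCLM_apply]
  rw [h1, ContinuousLinearMap.iteratedFDeriv_comp_right (phaseCLM k) hf x
    (by exact_mod_cast le_top)]
  refine (ContinuousMultilinearMap.norm_compContinuousLinearMap_le _ _).trans ?_
  rw [norm_iteratedFDeriv_eq_norm_iteratedDeriv, Finset.prod_const, Finset.card_univ,
    Fintype.card_fin]
  calc _ ≤ 1 * weight k ^ n := by
        gcongr
        · exact hf1 n _
        · exact norm_phaseCLM_le k
    _ ≤ weight k ^ N := by
      rw [one_mul]
      exact pow_le_pow_right₀ (one_le_weight k) hn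

theorem cbound_cosMode (N : ℕ) (k : Fin d → ℤ) : CBound N (cosMode k) (weight k ^ N) :=
  cbound_comp_phase N k Real.contDiff_cos Real.abs_iteratedDeriv_cos_le_one _ fun _ => rfl

theorem cbound_sinMode (N : ℕ) (k : Fin d → ℤ) : CBound N (sinMode k) (weight k ^ N) :=
  cbound_comp_phase N k Real.contDiff_sin Real.abs_iteratedDeriv_sin_le_one _ fun _ => rfl

/-- The pairing of a distribution with a smooth function, bounded by the Fourier coefficients. -/
theorem enorm_apply_le_tsum (u : PeriodicDistribution d) {φ : SmoothFun d}
    (hφ : ∀ N : ℕ, Summable fun n => weight n ^ N * ‖coeff φ n‖) :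
    ‖u φ‖ₑ ≤ ∑' n, ‖coeff φ n‖ₑ * ‖distFourierCoeff u n‖ₑ := by
  -- The real part of `c exp (iθ)` is `Re c cos θ - Im c sin θ`. As `φ` is real, taking real parts
  -- in its Fourier series keeps every term in the space of real test functions.
  set f : (Fin d → ℤ) → SmoothFun d := fun n =>
    (coeff φ n).re • cosMode n + (-(coeff φ n).im) • sinMode n with hf
  have hsum : HasSum (fun n => u (f n)) (u φ) := by
    refine u.hasSum (fun x => ?_) fun N => ?_
    · have hs : Summable (mFourierCoeff (torusLift φ)) := by
        refine Summable.of_norm ?_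
        simpa using! hφ 0
      have h1 := Complex.hasSum_re (hasSum_mFourier_series_apply_of_summable hs (toTorus x))
      rw [torusLift_toTorus, Complex.ofReal_re] at h1
      refine h1.congr_fun ?_
      intro n
      change ((coeff φ n).re * Real.cos (phase n x) + (-(coeff φ n).im) * Real.sin (phase n x)) =
        (coeff φ n * _).re
      rw [mFourier_toTorus, Complex.mul_re, Complex.exp_ofReal_mul_I_re,
        Complex.exp_ofReal_mul_I_im]
      ring
    · refine ⟨fun n => 2 * (weight n ^ N * ‖coeff φ n‖), (hφ N).mul_left 2, fun n => ?_⟩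
      refine (((cbound_cosMode N n).smul _).add ((cbound_sinMode N n).smul _)).mono le_rfl ?_
      have h1 := Complex.abs_re_le_norm (coeff φ n)
      have h2 := Complex.abs_im_le_norm (coeff φ n)
      have h3 := pow_pos (weight_pos n) N
      rw [abs_neg]
      nlinarith
  rw [← hsum.tsum_eq]
  refine (enorm_tsum_le_tsum_enorm).trans (ENNReal.tsum_le_tsum fun n => ?_)
  have h1 : u (f n) = (coeff φ n * (starRingEnd ℂ) (distFourierCoeff u n)).re := by
    simp only [hf, map_add, map_smul, smul_eq_mul, distFourierCoeff, Complex.mul_re]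
    simp
    ring
  rw [h1, ← RCLike.enorm_conj (distFourierCoeff u n), ← enorm_mul]
  have := Complex.abs_re_le_norm (coeff φ n * (starRingEnd ℂ) (distFourierCoeff u n))
  rw [← ofReal_norm, ← ofReal_norm]
  exact ENNReal.ofReal_le_ofReal this

/-- Makes `enorm_apply_le_tsum` applicable to products of `v` with a mode of frequency `k`. By
Peetre's inequality a shift by `k` costs `(2 * weight k) ^ N`; dependence on `k` is harmless, as
only summability is claimed. -/
theorem summable_weight_pow_mul_of_shift {v φ : SmoothFun d} (hv : ∀ b, ∃ M, CBound b v M)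
    (k : Fin d → ℤ) (h : ∀ n, ‖coeff φ n‖ ≤ ‖coeff v (n - k)‖ + ‖coeff v (n + k)‖) (N : ℕ) :
    Summable fun n => weight n ^ N * ‖coeff φ n‖ := by
  have hs := summable_weight_pow_mul_norm_coeff hv N
  have h1 := ((Equiv.subRight k).summable_iff.2 hs).add ((Equiv.addRight k).summable_iff.2 hs)
  refine Summable.of_nonneg_of_le (fun n => by have := weight_pos n; positivity) (fun n => ?_)
    (h1.mul_left ((2 * weight k) ^ N))
  have e1 : weight n ≤ 2 * weight k * weight (n - k) := by
    simpa [mul_assoc] using weight_add_le k (n - k)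
  have e2 : weight n ≤ 2 * weight k * weight (n + k) := by
    have := weight_add_le (-k) (n + k)
    rw [weight_neg] at this
    simpa [mul_assoc] using this
  have hn := (weight_pos n).le
  have f1 := pow_le_pow_left₀ hn e1 N
  have f2 := pow_le_pow_left₀ hn e2 N
  rw [mul_pow] at f1 f2
  simp only [Function.comp_apply, Equiv.subRight_apply, Equiv.coe_addRight]
  calc _ ≤ weight n ^ N * (‖coeff v (n - k)‖ + ‖coeff v (n + k)‖) := by gcongr; exact h n
    _ ≤ (2 * weight k) ^ N * weight (n - k) ^ N * ‖coeff v (n - k)‖ +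
        (2 * weight k) ^ N * weight (n + k) ^ N * ‖coeff v (n + k)‖ := by
      rw [mul_add]; gcongr
    _ = _ := by ring

/-! ### Energies and multiplication operators on Sobolev spaces -/

/-- The square of the Sobolev norm. -/
def energy (s : ℝ) (u : PeriodicDistribution d) : ℝ≥0∞ :=
  ∑' k, ENNReal.ofReal (weight k ^ s) * ‖distFourierCoeff u k‖ₑ ^ 2

theorem energy_eq (s : ℝ) (u : PeriodicDistribution d) : energy s u = sobolevNorm s u ^ 2 := by
  rw [sobolevNorm, ← ENNReal.rpow_natCast, ← ENNReal.rpow_mul]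
  norm_num
  refine tsum_congr fun k => ?_
  change _ = ENNReal.ofReal (weight k ^ s * _)
  rw [ENNReal.ofReal_mul (Real.rpow_nonneg (weight_pos k).le s), ENNReal.ofReal_pow (norm_nonneg _),
    ofReal_norm]

/-- Cauchy--Schwarz for weighted series. -/
theorem sq_tsum_mul_le {ι : Type*} (q x : ι → ℝ≥0∞) :
    (∑' i, q i * x i) ^ 2 ≤ (∑' i, q i) * ∑' i, q i * x i ^ 2 := by
  -- Hölder's inequality for the counting measure, after splitting `q * x` as `q ^ (1/2) * (q ^
  -- (1/2) * x)`.
  let _ : MeasurableSpace ι := ⊤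
  have h := ENNReal.lintegral_mul_le_Lp_mul_Lq (Measure.count : Measure ι)
    Real.HolderConjugate.two_two (f := fun i => q i ^ (1 / 2 : ℝ))
    (g := fun i => q i ^ (1 / 2 : ℝ) * x i) Measurable.of_discrete.aemeasurable
    Measurable.of_discrete.aemeasurable
  have hq2 : ∀ i, q i ^ (1 / 2 : ℝ) * q i ^ (1 / 2 : ℝ) = q i := fun i => by
    rw [← ENNReal.rpow_add_of_nonneg _ _ (by norm_num) (by norm_num)]
    norm_num
  simp only [lintegral_count, Pi.mul_apply, ← mul_assoc, hq2, ENNReal.rpow_two, mul_pow,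
    pow_two (q _ ^ (1 / 2 : ℝ))] at h
  have h3 := pow_le_pow_left₀ zero_le h 2
  rw [mul_pow, ← ENNReal.rpow_natCast, ← ENNReal.rpow_natCast, ← ENNReal.rpow_natCast,
    ← ENNReal.rpow_mul, ← ENNReal.rpow_mul] at h3
  norm_num at h3
  simpa [pow_two] using h3

/-- Schur's test for the kernel `q (n - k) + q (n + k)` in the weighted spaces. -/
theorem tsum_weight_mul_sq_conv_le (s : ℝ) (q x : (Fin d → ℤ) → ℝ≥0∞) :
    ∑' k, ENNReal.ofReal (weight k ^ s) * (∑' n, (q (n - k) + q (n + k)) * x n) ^ 2 ≤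
      (4 * ENNReal.ofReal (2 ^ |s|) * (∑' n, q n) *
        ∑' n, ENNReal.ofReal (weight n ^ |s|) * q n) *
        ∑' n, ENNReal.ofReal (weight n ^ s) * x n ^ 2 := by
  set W : (Fin d → ℤ) → ℝ≥0∞ := fun k => ENNReal.ofReal (weight k ^ s) with hW
  set Q₁ : ℝ≥0∞ := ∑' n, q n
  set Q₂ : ℝ≥0∞ := ∑' n, ENNReal.ofReal (weight n ^ |s|) * q n
  have hrow : ∀ k, ∑' n, (q (n - k) + q (n + k)) = 2 * Q₁ := fun k => by
    have e1 : ∑' n, q (n - k) = Q₁ := (Equiv.subRight k).tsum_eq q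
    have e2 : ∑' n, q (n + k) = Q₁ := (Equiv.addRight k).tsum_eq q
    rw [ENNReal.tsum_add, e1, e2, two_mul]
  have hcol1 : ∀ n, ∑' k, W k * q (n - k) ≤ ENNReal.ofReal (2 ^ |s|) * W n * Q₂ := fun n => by
    calc ∑' k, W k * q (n - k) ≤ ∑' k, ENNReal.ofReal (2 ^ |s|) * W n *
          (ENNReal.ofReal (weight (n - k) ^ |s|) * q (n - k)) := by
          refine ENNReal.tsum_le_tsum fun k => ?_
          rw [← mul_assoc]
          refine mul_le_mul_left ?_ _
          have hn := Real.rpow_nonneg (weight_pos n).le s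
          rw [← ENNReal.ofReal_mul (by positivity), ← ENNReal.ofReal_mul (by positivity)]
          exact ENNReal.ofReal_le_ofReal (weight_rpow_le s k n)
      _ = _ := by
        have e1 : ∑' k, ENNReal.ofReal (weight (n - k) ^ |s|) * q (n - k) = Q₂ :=
          (Equiv.subLeft n).tsum_eq fun m => ENNReal.ofReal (weight m ^ |s|) * q m
        rw [ENNReal.tsum_mul_left, e1]
  -- The reflection `k ↦ -k` preserves the weights and turns this kernel into the previous one.
  have hcol2 : ∀ n, ∑' k, W k * q (n + k) ≤ ENNReal.ofReal (2 ^ |s|) * W n * Q₂ := fun n => by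
    refine le_trans (le_of_eq ?_) (hcol1 n)
    rw [← (Equiv.neg (Fin d → ℤ)).tsum_eq]
    refine tsum_congr fun k => ?_
    simp [hW, weight_neg, sub_eq_add_neg]
  calc ∑' k, W k * (∑' n, (q (n - k) + q (n + k)) * x n) ^ 2
      ≤ ∑' k, W k * (2 * Q₁ * ∑' n, (q (n - k) + q (n + k)) * x n ^ 2) := by
        refine ENNReal.tsum_le_tsum fun k => ?_
        gcongr
        rw [← hrow k]
        exact sq_tsum_mul_le _ _
    _ = 2 * Q₁ * ∑' n, (∑' k, W k * q (n - k) + ∑' k, W k * q (n + k)) * x n ^ 2 := by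
        simp only [← ENNReal.tsum_add, ← ENNReal.tsum_mul_left, ← ENNReal.tsum_mul_right]
        rw [ENNReal.tsum_comm]
        refine tsum_congr fun n => tsum_congr fun k => ?_
        ring
    _ ≤ 2 * Q₁ * ∑' n, (ENNReal.ofReal (2 ^ |s|) * W n * Q₂ +
          ENNReal.ofReal (2 ^ |s|) * W n * Q₂) * x n ^ 2 := by
        gcongr with n
        · exact hcol1 n
        · exact hcol2 n
    _ = 2 * Q₁ * ∑' n, (2 * ENNReal.ofReal (2 ^ |s|) * Q₂) * (W n * x n ^ 2) := by
        congr 1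
        refine tsum_congr fun n => ?_
        ring
    _ = _ := by
        rw [ENNReal.tsum_mul_left]
        ring

/-- Multiplication by a smooth function is bounded on the Sobolev spaces. -/
theorem exists_tsum_mul_mode_le (s : ℝ) (M : ℕ → ℝ) : ∃ C : ℝ≥0∞, C ≠ ⊤ ∧
    ∀ v : SmoothFun d, (∀ b, CBound b v (M b)) → ∀ u : PeriodicDistribution d,
      ∑' k, ENNReal.ofReal (weight k ^ s) *
        (‖u (v * cosMode k)‖ₑ ^ 2 + ‖u (v * sinMode k)‖ₑ ^ 2) ≤ C * energy s u := by
  -- Of these powers of decay, `⌈|s|⌉₊` absorb Peetre's factor `weight ^ |s|` and `d` make the sum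
  -- converge. The absolute value in `B` gives positivity before any `v` is at hand.
  set N : ℕ := ⌈|s|⌉₊ + d
  set B : ℝ := (1 + d) ^ N * |M (2 * N)|
  have hB : 0 ≤ B := by positivity
  set q : (Fin d → ℤ) → ℝ≥0∞ := fun n => ENNReal.ofReal (B * (weight n ^ N)⁻¹) with hq
  have hsummable := tsum_inv_weight_pow_ne_top d
  have hq2 : ∀ n, ENNReal.ofReal (weight n ^ |s|) * q n ≤
      ENNReal.ofReal B * ENNReal.ofReal ((weight n ^ d)⁻¹) := fun n => by
    have hw := weight_pos n
    rw [hq, ← ENNReal.ofReal_mul (by positivity), ← ENNReal.ofReal_mul hB]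
    refine ENNReal.ofReal_le_ofReal ?_
    have h1 : weight n ^ |s| ≤ weight n ^ ⌈|s|⌉₊ := by
      rw [← Real.rpow_natCast]
      exact Real.rpow_le_rpow_of_exponent_le (one_le_weight n) (Nat.le_ceil _)
    calc weight n ^ |s| * (B * (weight n ^ N)⁻¹)
        ≤ weight n ^ ⌈|s|⌉₊ * (B * (weight n ^ N)⁻¹) := by gcongr
      _ = B * (weight n ^ d)⁻¹ := by
        rw [pow_add]; field_simp
  have hq1 : ∀ n, q n ≤ ENNReal.ofReal (weight n ^ |s|) * q n := fun n => by
    refine le_mul_of_one_le_left' ?_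
    rw [ENNReal.one_le_ofReal]
    exact Real.one_le_rpow (one_le_weight n) (abs_nonneg s)
  have hQ2 : ∑' n, ENNReal.ofReal (weight n ^ |s|) * q n ≠ ⊤ := by
    refine ne_top_of_le_ne_top ?_ (ENNReal.tsum_le_tsum hq2)
    rw [ENNReal.tsum_mul_left]
    exact ENNReal.mul_ne_top ENNReal.ofReal_ne_top hsummable
  have hQ1 : ∑' n, q n ≠ ⊤ := ne_top_of_le_ne_top hQ2 (ENNReal.tsum_le_tsum hq1)
  refine ⟨2 * (4 * ENNReal.ofReal (2 ^ |s|) * (∑' n, q n) *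
        ∑' n, ENNReal.ofReal (weight n ^ |s|) * q n), by finiteness, fun v hv u => ?_⟩
  have hex : ∀ b, ∃ M, CBound b v M := fun b => ⟨_, hv b⟩
  have hcoeff : ∀ n, ‖coeff v n‖ₑ ≤ q n := fun n => by
    rw [← ofReal_norm]
    exact ENNReal.ofReal_le_ofReal
      (norm_coeff_le_weight N ((hv (2 * N)).mono le_rfl (le_abs_self _)) n)
  have key : ∀ (k : Fin d → ℤ) (φ : SmoothFun d),
      (∀ n, ‖coeff φ n‖ ≤ ‖coeff v (n - k)‖ + ‖coeff v (n + k)‖) →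
      ‖u φ‖ₑ ≤ ∑' n, (q (n - k) + q (n + k)) * ‖distFourierCoeff u n‖ₑ := fun k φ hφ => by
    refine (enorm_apply_le_tsum u (summable_weight_pow_mul_of_shift hex k hφ)).trans ?_
    refine ENNReal.tsum_le_tsum fun n => ?_
    gcongr
    calc ‖coeff φ n‖ₑ ≤ ‖coeff v (n - k)‖ₑ + ‖coeff v (n + k)‖ₑ := by
          rw [← ofReal_norm, ← ofReal_norm, ← ofReal_norm,
            ← ENNReal.ofReal_add (norm_nonneg _) (norm_nonneg _)]
          exact ENNReal.ofReal_le_ofReal (hφ n)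
      _ ≤ _ := add_le_add (hcoeff _) (hcoeff _)
  calc _ ≤ ∑' k, 2 * (ENNReal.ofReal (weight k ^ s) *
          (∑' n, (q (n - k) + q (n + k)) * ‖distFourierCoeff u n‖ₑ) ^ 2) := by
        refine ENNReal.tsum_le_tsum fun k => ?_
        have h1 := key k _ (norm_coeff_mul_cosMode_le v k)
        have h2 := key k _ (norm_coeff_mul_sinMode_le v k)
        rw [mul_left_comm, two_mul]
        gcongr
    _ ≤ _ := by
        rw [ENNReal.tsum_mul_left, mul_assoc]
        gcongr
        exact tsum_weight_mul_sq_conv_le s q _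

/-! ### The modes of a weak solution -/

theorem partialDeriv_cosMode (l : Fin d) (k : Fin d → ℤ) :
    partialDeriv l (cosMode k) = (-(2 * Real.pi * k l)) • sinMode k := by
  ext x
  have h := hasDerivAt_smooth (cosMode k) l x 0
  have h0 : HasDerivAt (fun s : ℝ => phase k (x + s • EuclideanSpace.single l (1 : ℝ)))
      (2 * Real.pi * k l) 0 := by
    have : (fun s : ℝ => phase k (x + s • EuclideanSpace.single l (1 : ℝ))) =
        fun s => phase k x + 2 * Real.pi * k l * s := by
      funext s
      rw [← phase_single, ← phaseCLM_apply, ← phaseCLM_apply, ← phaseCLM_apply, map_add]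
    rw [this]
    simpa using ((hasDerivAt_id (0 : ℝ)).const_mul (2 * Real.pi * k l)).const_add (phase k x)
  have h2 := h.unique (f := fun s => Real.cos (phase k (x + s • EuclideanSpace.single l (1 : ℝ))))
    h0.cos
  simp only [zero_smul, add_zero] at h2
  rw [h2]
  change _ = -(2 * Real.pi * k l) * Real.sin (phase k x)
  ring

theorem partialDeriv_sinMode (l : Fin d) (k : Fin d → ℤ) :
    partialDeriv l (sinMode k) = (2 * Real.pi * k l) • cosMode k := by
  ext x
  have h := hasDerivAt_smooth (sinMode k) l x 0
  have h0 : HasDerivAt (fun s : ℝ => phase k (x + s • EuclideanSpace.single l (1 : ℝ)))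
      (2 * Real.pi * k l) 0 := by
    have : (fun s : ℝ => phase k (x + s • EuclideanSpace.single l (1 : ℝ))) =
        fun s => phase k x + 2 * Real.pi * k l * s := by
      funext s
      rw [← phase_single, ← phaseCLM_apply, ← phaseCLM_apply, ← phaseCLM_apply, map_add]
    rw [this]
    simpa using ((hasDerivAt_id (0 : ℝ)).const_mul (2 * Real.pi * k l)).const_add (phase k x)
  have h2 := h.unique (f := fun s => Real.sin (phase k (x + s • EuclideanSpace.single l (1 : ℝ))))
    h0.sin
  simp only [zero_smul, add_zero] at h2
  rw [h2]
  change _ = (2 * Real.pi * k l) * Real.cos (phase k x)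
  ring

theorem partialDeriv_smul (l : Fin d) (c : ℝ) (v : SmoothFun d) :
    partialDeriv l (c • v) = c • partialDeriv l v := by
  ext x
  change fderiv ℝ (c • (v : E d → ℝ)) x _ = c • fderiv ℝ (v : E d → ℝ) x _
  rw [fderiv_const_smul ((contDiff_smoothFun v).differentiable (by simp) x)]
  rfl

theorem laplacian_cosMode (k : Fin d → ℤ) :
    laplacian (cosMode k) = (-eigenvalue k) • cosMode k := by
  simp only [laplacian, partialDeriv_cosMode, partialDeriv_smul, partialDeriv_sinMode, smul_smul]
  rw [← Finset.sum_smul, eigenvalue, Finset.mul_sum, ← Finset.sum_neg_distrib]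
  congr 1
  exact Finset.sum_congr rfl fun i _ => by ring

theorem laplacian_sinMode (k : Fin d → ℤ) :
    laplacian (sinMode k) = (-eigenvalue k) • sinMode k := by
  simp only [laplacian, partialDeriv_cosMode, partialDeriv_smul, partialDeriv_sinMode, smul_smul]
  rw [← Finset.sum_smul, eigenvalue, Finset.mul_sum, ← Finset.sum_neg_distrib]
  congr 1
  exact Finset.sum_congr rfl fun i _ => by ring

/-! ### Variation of constants and the estimate for one mode -/

/-- The variation of constants formula for a weakly differentiable function. -/
theorem IsWeakTimeDeriv.exp_mul_eq {T : ℝ} {p p' : ℝ → ℝ} (hp : IsWeakTimeDeriv T p p') (l : ℝ)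
    {t₀ t : ℝ} (h0 : 0 ≤ t₀) (h1 : t₀ ≤ t) (h2 : t ≤ T) :
    Real.exp (l * t) * p t = Real.exp (l * t₀) * p t₀ +
      ∫ s in t₀..t, Real.exp (l * s) * (p' s + l * p s) := by
  have hT : 0 ≤ T := h0.trans (h1.trans h2)
  have hint : IntervalIntegrable p' volume 0 T := by
    rw [intervalIntegrable_iff_integrableOn_Icc_of_le hT]
    exact hp.1
  -- Nothing is known of `p` outside `[0,T]`, so absolute continuity and derivatives are taken for
  -- the primitive `P`, which agrees with `p` on `[0,T]`.
  set P : ℝ → ℝ := fun s => p 0 + ∫ r in (0 : ℝ)..s, p' r with hP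
  have hPeq : ∀ s ∈ Icc 0 T, P s = p s := fun s hs => (hp.2 s hs).symm
  have hsub : uIcc t₀ t ⊆ uIcc 0 T := by
    rw [uIcc_of_le h1, uIcc_of_le hT]
    exact Icc_subset_Icc h0 h2
  have hac : AbsolutelyContinuousOnInterval P t₀ t := by
    have h3 := (hint.absolutelyContinuousOnInterval_intervalIntegral (c := 0) (by simp)).mono hsub
    have h4 : AbsolutelyContinuousOnInterval (fun _ : ℝ => p 0) t₀ t :=
      ContDiffOn.absolutelyContinuousOnInterval contDiffOn_const
    exact h4.add h3
  have hexp : AbsolutelyContinuousOnInterval (fun s => Real.exp (l * s)) t₀ t :=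
    ContDiffOn.absolutelyContinuousOnInterval
      (ContDiff.contDiffOn (by fun_prop))
  have key := hexp.integral_deriv_mul_eq_sub hac
  have hcongr : ∫ x in t₀..t, deriv (fun s => Real.exp (l * s)) x * P x +
      Real.exp (l * x) * deriv P x = ∫ s in t₀..t, Real.exp (l * s) * (p' s + l * p s) := by
    refine intervalIntegral.integral_congr_ae ?_
    filter_upwards [hint.ae_hasDerivAt_integral] with x hx hxm
    have hx2 : x ∈ uIcc 0 T := hsub (uIoc_subset_uIcc hxm)
    have h3 : HasDerivAt P (p' x) x := (hx hx2 0 (by simp)).const_add (p 0)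
    have h4 : HasDerivAt (fun s => Real.exp (l * s)) (Real.exp (l * x) * l) x := by
      simpa using ((hasDerivAt_id x).const_mul l).exp
    rw [h3.deriv, h4.deriv, hPeq x (by rwa [uIcc_of_le hT] at hx2)]
    ring
  rw [hcongr, hPeq t ⟨h0.trans h1, h2⟩, hPeq t₀ ⟨h0, h1.trans h2⟩] at key
  linarith

theorem sq_lintegral_mul_le {α : Type*} [MeasurableSpace α] (μ : Measure α) {f g : α → ℝ≥0∞}
    (hf : AEMeasurable f μ) (hg : AEMeasurable g μ) :
    (∫⁻ x, f x * g x ∂μ) ^ 2 ≤ (∫⁻ x, f x ^ 2 ∂μ) * ∫⁻ x, g x ^ 2 ∂μ := by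
  have h := pow_le_pow_left₀ zero_le
    (ENNReal.lintegral_mul_le_Lp_mul_Lq μ Real.HolderConjugate.two_two hf hg) 2
  rw [mul_pow, ← ENNReal.rpow_natCast, ← ENNReal.rpow_natCast, ← ENNReal.rpow_natCast,
    ← ENNReal.rpow_mul, ← ENNReal.rpow_mul] at h
  norm_num at h
  simpa using h

theorem add_sq_le_two_mul (x y : ℝ≥0∞) : (x + y) ^ 2 ≤ 2 * x ^ 2 + 2 * y ^ 2 := by
  have := ENNReal.rpow_add_le_mul_rpow_add_rpow x y (one_le_two (α := ℝ))
  norm_num at this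
  rw [← mul_add]
  exact this

/-- The source of the gained derivative. For the summand `1`, the exponential is at most `1` on an
interval of length at most `T`; for the summand `l`, the explicit antiderivative bounds `2 l` times
the integral by `1`, uniformly in `l`. -/
theorem weight_mul_lintegral_exp_le {l T t₀ t : ℝ} (hl : 0 ≤ l) (h0 : 0 ≤ t₀) (h1 : t₀ ≤ t)
    (h2 : t ≤ T) :
    ENNReal.ofReal (1 + l) * ∫⁻ s in Ioc t₀ t, ENNReal.ofReal (Real.exp (-l * (t - s))) ^ 2 ≤
      ENNReal.ofReal (T + 1) := by
  have hexp : ∀ s, ENNReal.ofReal (Real.exp (-l * (t - s))) ^ 2 =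
      ENNReal.ofReal (Real.exp (2 * l * (s - t))) := fun s => by
    rw [← ENNReal.ofReal_pow (Real.exp_pos _).le, ← Real.exp_nat_mul]
    congr 2
    push_cast
    ring
  simp only [hexp]
  have hint : ∀ c : ℝ, IntervalIntegrable (fun s => c * Real.exp (2 * l * (s - t))) volume t₀ t :=
    fun c => Continuous.intervalIntegrable (by fun_prop) _ _
  have hint1 := hint 1
  simp only [one_mul] at hint1
  rw [← ofReal_integral_eq_lintegral_ofReal
    ((intervalIntegrable_iff_integrableOn_Ioc_of_le h1).1 hint1)
    (ae_of_all _ fun s => (Real.exp_pos _).le), ← ENNReal.ofReal_mul (by positivity),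
    ← intervalIntegral.integral_of_le h1]
  refine ENNReal.ofReal_le_ofReal ?_
  have hA : ∫ s in t₀..t, Real.exp (2 * l * (s - t)) ≤ T := by
    calc _ ≤ ∫ _s in t₀..t, (1 : ℝ) := by
          refine intervalIntegral.integral_mono_on h1 hint1 (by simp) fun s hs => ?_
          rw [Real.exp_le_one_iff]
          nlinarith [hs.2]
      _ ≤ T := by simp; linarith
  have hB : (2 * l) * ∫ s in t₀..t, Real.exp (2 * l * (s - t)) ≤ 1 := by
    have hd : ∀ s ∈ uIcc t₀ t, HasDerivAt (fun s => Real.exp (2 * l * (s - t)))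
        ((2 * l) * Real.exp (2 * l * (s - t))) s := fun s _ => by
      have := ((((hasDerivAt_id s).sub_const t)).const_mul (2 * l)).exp
      simpa [mul_comm] using this
    rw [← intervalIntegral.integral_const_mul,
      intervalIntegral.integral_eq_sub_of_hasDerivAt hd (hint _)]
    simp [(Real.exp_pos _).le]
  nlinarith

/-- The smoothing estimate for a single mode. -/
theorem IsWeakTimeDeriv.weight_mul_sq_le {T : ℝ} {p p' : ℝ → ℝ} (hp : IsWeakTimeDeriv T p p')
    (hpm : AEMeasurable p (volume.restrict (Icc 0 T))) {l : ℝ} (hl : 0 ≤ l)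
    {t₀ t : ℝ} (h0 : 0 ≤ t₀) (h1 : t₀ ≤ t) (h2 : t ≤ T) :
    ENNReal.ofReal (1 + l) * ‖p t‖ₑ ^ 2 ≤
      2 * (ENNReal.ofReal ((1 + l) * Real.exp (-(2 * l * (t - t₀)))) * ‖p t₀‖ₑ ^ 2) +
      2 * ENNReal.ofReal (T + 1) * ∫⁻ s in Ioc t₀ t, ‖p' s + l * p s‖ₑ ^ 2 := by
  have hsub : Ioc t₀ t ⊆ Icc 0 T := fun s hs => ⟨h0.trans hs.1.le, hs.2.trans h2⟩
  have hrm : AEMeasurable (fun s => p' s + l * p s) (volume.restrict (Ioc t₀ t)) :=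
    ((hp.1.1.aemeasurable.mono_set hsub)).add ((hpm.mono_set hsub).const_mul l)
  have hform : p t = Real.exp (-l * (t - t₀)) * p t₀ +
      ∫ s in Ioc t₀ t, Real.exp (-l * (t - s)) * (p' s + l * p s) := by
    have h3 := hp.exp_mul_eq l h0 h1 h2
    have h4 : p t = Real.exp (-l * t) * (Real.exp (l * t) * p t) := by
      rw [← mul_assoc, ← Real.exp_add]
      simp
    rw [h4, h3, mul_add, ← mul_assoc, ← Real.exp_add, intervalIntegral.integral_of_le h1,
      ← integral_const_mul]
    congr 3
    · ring
    · funext s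
      rw [← mul_assoc, ← Real.exp_add]
      congr 2
      ring
  have hbound : ‖p t‖ₑ ≤ ENNReal.ofReal (Real.exp (-l * (t - t₀))) * ‖p t₀‖ₑ +
      ∫⁻ s in Ioc t₀ t, ENNReal.ofReal (Real.exp (-l * (t - s))) * ‖p' s + l * p s‖ₑ := by
    conv_lhs => rw [hform]
    refine (enorm_add_le _ _).trans (add_le_add (le_of_eq ?_) ?_)
    · rw [enorm_mul, Real.enorm_of_nonneg (Real.exp_pos _).le]
    · refine (enorm_integral_le_lintegral_enorm _).trans (le_of_eq ?_)
      refine lintegral_congr fun s => ?_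
      rw [enorm_mul, Real.enorm_of_nonneg (Real.exp_pos _).le]
  have hexp0 : ENNReal.ofReal (Real.exp (-l * (t - t₀))) ^ 2 =
      ENNReal.ofReal (Real.exp (-(2 * l * (t - t₀)))) := by
    rw [← ENNReal.ofReal_pow (Real.exp_pos _).le, ← Real.exp_nat_mul]
    congr 2
    push_cast
    ring
  have hcs := sq_lintegral_mul_le (volume.restrict (Ioc t₀ t))
    (f := fun s => ENNReal.ofReal (Real.exp (-l * (t - s)))) (g := fun s => ‖p' s + l * p s‖ₑ)
    (by fun_prop) hrm.enorm
  calc _ ≤ ENNReal.ofReal (1 + l) *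
        (2 * (ENNReal.ofReal (Real.exp (-l * (t - t₀))) * ‖p t₀‖ₑ) ^ 2 +
        2 * ((∫⁻ s in Ioc t₀ t, ENNReal.ofReal (Real.exp (-l * (t - s))) ^ 2) *
          ∫⁻ s in Ioc t₀ t, ‖p' s + l * p s‖ₑ ^ 2)) := by
        gcongr
        refine (pow_le_pow_left₀ zero_le hbound 2).trans ((add_sq_le_two_mul _ _).trans ?_)
        gcongr
    _ = 2 * ((ENNReal.ofReal (1 + l) * ENNReal.ofReal (Real.exp (-(2 * l * (t - t₀))))) *
          ‖p t₀‖ₑ ^ 2) +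
        2 * (ENNReal.ofReal (1 + l) *
          ∫⁻ s in Ioc t₀ t, ENNReal.ofReal (Real.exp (-l * (t - s))) ^ 2) *
          ∫⁻ s in Ioc t₀ t, ‖p' s + l * p s‖ₑ ^ 2 := by
        rw [mul_pow, hexp0]
        ring
    _ ≤ _ := by
        rw [← ENNReal.ofReal_mul (by positivity)]
        gcongr
        exact weight_mul_lintegral_exp_le hl h0 h1 h2

/-- Uses `x exp (-x) ≤ 1` at `x = 2 l τ`: after a positive time, damping pays for one factor `1 +
l`, uniformly in `l`. -/
theorem one_add_mul_exp_le {l τ : ℝ} (hl : 0 ≤ l) (hτ : 0 < τ) :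
    (1 + l) * Real.exp (-(2 * l * τ)) ≤ 1 + 1 / (2 * τ) := by
  have h1 : 2 * l * τ * Real.exp (-(2 * l * τ)) ≤ 1 := by
    have := Real.add_one_le_exp (2 * l * τ)
    rw [Real.exp_neg, ← div_eq_mul_inv, div_le_one (Real.exp_pos _)]
    linarith
  have h2 : Real.exp (-(2 * l * τ)) ≤ 1 := by
    rw [Real.exp_le_one_iff]
    have := mul_nonneg hl hτ.le
    linarith
  have h3 : l * Real.exp (-(2 * l * τ)) ≤ 1 / (2 * τ) := by
    rw [le_div_iff₀ (by positivity)]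
    linarith
  linarith

/-! ### Grönwall's inequality for measurable functions -/

/-- Grönwall's inequality for an integrable function with values in `[0,∞]`. -/
theorem le_mul_of_le_add_mul_lintegral {T K A : ℝ} (hK : 0 < K) (hA : 0 ≤ A) {f : ℝ → ℝ≥0∞}
    (hf : AEMeasurable f (volume.restrict (Icc 0 T))) (hfi : ∫⁻ t in Icc 0 T, f t ≠ ⊤)
    (h : ∀ t ∈ Icc 0 T, f t ≤ ENNReal.ofReal A + ENNReal.ofReal K * ∫⁻ s in Ioc 0 t, f s)
    {t : ℝ} (ht : t ∈ Icc 0 T) :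
    f t ≤ ENNReal.ofReal ((1 + K * T * (1 + Real.exp (K * T))) * A) := by
  have hT : 0 ≤ T := ht.1.trans ht.2
  set F : ℝ → ℝ := fun t => ∫ s in (0 : ℝ)..t, (f s).toReal with hF
  have hint : IntegrableOn (fun s => (f s).toReal) (Icc 0 T) :=
    integrable_toReal_of_lintegral_ne_top hf hfi
  have hII : IntervalIntegrable (fun s => (f s).toReal) volume 0 T := by
    rwa [intervalIntegrable_iff_integrableOn_Icc_of_le hT]
  have hFc : ContinuousOn F (Icc 0 T) := by
    have := intervalIntegral.continuousOn_primitive_interval (a := 0) (b := T)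
      (f := fun s => (f s).toReal) (μ := volume) (by rwa [uIcc_of_le hT])
    rwa [uIcc_of_le hT] at this
  have hFnn : ∀ t ∈ Icc 0 T, 0 ≤ F t := fun t ht =>
    intervalIntegral.integral_nonneg ht.1 fun _ _ => ENNReal.toReal_nonneg
  have hlin : ∀ t ∈ Icc 0 T, ∫⁻ s in Ioc 0 t, f s = ENNReal.ofReal (F t) := fun t ht => by
    have hsub : Ioc 0 t ⊆ Icc 0 T := fun s hs => ⟨hs.1.le, hs.2.trans ht.2⟩
    rw [hF]
    dsimp only
    rw [intervalIntegral.integral_of_le ht.1, ofReal_integral_eq_lintegral_ofReal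
      (hint.mono_set hsub) (ae_of_all _ fun _ => ENNReal.toReal_nonneg)]
    refine lintegral_congr_ae ?_
    filter_upwards [ae_lt_top' (hf.mono_set hsub)
      (ne_top_of_le_ne_top hfi (lintegral_mono_set hsub))] with s hs
    rw [ENNReal.ofReal_toReal hs.ne]
  have hfF : ∀ t ∈ Icc 0 T, f t ≤ ENNReal.ofReal (A + K * F t) := fun t ht => by
    refine (h t ht).trans_eq ?_
    rw [hlin t ht, ENNReal.ofReal_add hA (mul_nonneg hK.le (hFnn t ht)), ENNReal.ofReal_mul hK.le]
  -- The primitive `F` of `f` is continuous but need not be differentiable everywhere. Integrating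
  -- once more gives `G` with right derivative `F ≤ K * G + A * T`, to which the differential
  -- Grönwall inequality applies.
  set G : ℝ → ℝ := fun t => ∫ s in (0 : ℝ)..t, F s with hG
  have hFII : ∀ t ∈ Icc 0 T, IntervalIntegrable F volume 0 t := fun t ht =>
    ContinuousOn.intervalIntegrable (hFc.mono (by
      rw [uIcc_of_le ht.1]; exact Icc_subset_Icc le_rfl ht.2))
  have hGnn : ∀ t ∈ Icc 0 T, 0 ≤ G t := fun t ht =>
    intervalIntegral.integral_nonneg ht.1 fun s hs => hFnn s ⟨hs.1, hs.2.trans ht.2⟩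
  have hFG : ∀ t ∈ Icc 0 T, F t ≤ K * G t + A * T := fun t ht => by
    have hsub : Icc 0 t ⊆ Icc 0 T := Icc_subset_Icc le_rfl ht.2
    calc F t ≤ ∫ s in (0 : ℝ)..t, (A + K * F s) := by
          refine intervalIntegral.integral_mono_on ht.1 ?_ ?_ fun s hs => ?_
          · exact hII.mono_set (by
              rw [uIcc_of_le ht.1, uIcc_of_le hT]; exact hsub)
          · exact intervalIntegrable_const.add ((hFII t ht).const_mul K)
          · exact ENNReal.toReal_le_of_le_ofReal
              (add_nonneg hA (mul_nonneg hK.le (hFnn s (hsub hs)))) (hfF s (hsub hs))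
      _ = t * A + K * G t := by
          rw [intervalIntegral.integral_add intervalIntegrable_const ((hFII t ht).const_mul K),
            intervalIntegral.integral_const_mul]
          simp [hG]
      _ ≤ K * G t + A * T := by nlinarith [ht.2]
  have hGb : G t ≤ A * T / K * Real.exp (K * T) := by
    have hGc : ContinuousOn G (Icc 0 T) := by
      have := intervalIntegral.continuousOn_primitive_interval (a := 0) (b := T)
        (f := F) (μ := volume) (by rw [uIcc_of_le hT]; exact hFc.integrableOn_Icc)
      rwa [uIcc_of_le hT] at this
    have hGd : ∀ x ∈ Ico 0 T, HasDerivWithinAt G (F x) (Ici x) x := fun x hx => by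
      have hmem : Icc 0 T ∈ nhdsWithin x (Ioi x) :=
        Filter.mem_of_superset (Ioo_mem_nhdsGT hx.2) fun y hy => ⟨hx.1.trans hy.1.le, hy.2.le⟩
      refine intervalIntegral.integral_hasDerivWithinAt_right (t := Ioi x)
        (hFII x ⟨hx.1, hx.2.le⟩) ?_ ?_
      · exact ⟨_, hmem, hFc.aestronglyMeasurable measurableSet_Icc⟩
      · exact (hFc x ⟨hx.1, hx.2.le⟩).mono_of_mem_nhdsWithin hmem
    have h3 := norm_le_gronwallBound_of_norm_deriv_right_le (δ := 0) (K := K) (ε := A * T) hGc hGd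
      (by simp [hG]) (fun x hx => by
        have hx' : x ∈ Icc 0 T := ⟨hx.1, hx.2.le⟩
        rw [Real.norm_of_nonneg (hFnn x hx'), Real.norm_of_nonneg (hGnn x hx')]
        exact hFG x hx') t ht
    rw [Real.norm_of_nonneg (hGnn t ht), gronwallBound_of_K_ne_0 hK.ne'] at h3
    simp only [zero_mul, zero_add, sub_zero] at h3
    refine h3.trans ?_
    have h4 : Real.exp (K * t) ≤ Real.exp (K * T) := by
      rw [Real.exp_le_exp]; exact mul_le_mul_of_nonneg_left ht.2 hK.le
    gcongr
    linarith
  refine (hfF t ht).trans (ENNReal.ofReal_le_ofReal ?_)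
  have h5 : K * G t ≤ A * T * Real.exp (K * T) := by
    calc K * G t ≤ K * (A * T / K * Real.exp (K * T)) := by gcongr
      _ = _ := by field_simp
  have h6 := mul_le_mul_of_nonneg_left ((hFG t ht).trans (add_le_add_left h5 _)) hK.le
  linarith

/-! ### Energy estimates for weak solutions and bootstrapping -/

theorem enorm_distFourierCoeff_sq (u : PeriodicDistribution d) (k : Fin d → ℤ) :
    ‖distFourierCoeff u k‖ₑ ^ 2 = ‖u (cosMode k)‖ₑ ^ 2 + ‖u (sinMode k)‖ₑ ^ 2 := by
  have h : ‖distFourierCoeff u k‖ ^ 2 = ‖u (cosMode k)‖ ^ 2 + ‖u (sinMode k)‖ ^ 2 := by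
    rw [← Complex.normSq_eq_norm_sq, Complex.normSq_apply, distFourierCoeff]
    simp
    ring
  simp only [← ofReal_norm, ← ENNReal.ofReal_pow (norm_nonneg _)]
  rw [h, ENNReal.ofReal_add (by positivity) (by positivity)]

theorem energy_mono {s s' : ℝ} (h : s ≤ s') (u : PeriodicDistribution d) :
    energy s u ≤ energy s' u := by
  refine ENNReal.tsum_le_tsum fun k => ?_
  gcongr
  exact one_le_weight k

/-- The exponent `s` is unrelated to `r`: the terms of the series are built from measurable pairings
with modes. -/
theorem MemL2Sobolev.aemeasurable_energy {T r s : ℝ} {U : ℝ → PeriodicDistribution d}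
    (hU : MemL2Sobolev T r U) :
    AEMeasurable (fun t => energy s (U t)) (volume.restrict (Icc 0 T)) := by
  simp only [energy, enorm_distFourierCoeff_sq]
  refine AEMeasurable.tsum fun k => ?_
  exact (((hU.1 _).enorm.pow_const 2).add ((hU.1 _).enorm.pow_const 2)).const_mul _

/-- The parabolic smoothing estimate, which gains one derivative. -/
theorem exists_energy_add_one_le (T s : ℝ) {V : ℝ → SmoothFun d} {M : ℕ → ℝ}
    (hV : ∀ b, ∀ t ∈ Icc 0 T, CBound b (V t) (M b)) : ∃ C : ℝ≥0∞, C ≠ ⊤ ∧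
    ∀ {a : ℝ} {h : PeriodicDistribution d} {U : ℝ → PeriodicDistribution d},
      IsWeakSolution T a V h U → ∀ t₀ t : ℝ, 0 ≤ t₀ → t₀ ≤ t → t ≤ T →
      energy (s + 1) (U t) ≤ 2 * ∑' k, ENNReal.ofReal (weight k ^ s) *
          (ENNReal.ofReal (weight k * Real.exp (-(2 * eigenvalue k * (t - t₀)))) *
            ‖distFourierCoeff (U t₀) k‖ₑ ^ 2) +
        C * ∫⁻ r in Ioc t₀ t, energy s (U r) := by
  obtain ⟨C, hC, hmul⟩ := exists_tsum_mul_mode_le (d := d) s M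
  refine ⟨2 * ENNReal.ofReal (T + 1) * C, by finiteness, ?_⟩
  intro a h U hU t₀ t h0 h1 h2
  obtain ⟨dU, hdU, hder, heq⟩ := hU.equation
  have hsub : Ioc t₀ t ⊆ Icc 0 T := fun s hs => ⟨h0.trans hs.1.le, hs.2.trans h2⟩
  -- The squared forcing of mode `k`; by the equation it is almost everywhere the squared pairing of
  -- `U r` with `V r` times the two modes.
  set R : (Fin d → ℤ) → ℝ → ℝ≥0∞ := fun k r =>
    ‖dU r (cosMode k) + eigenvalue k * U r (cosMode k)‖ₑ ^ 2 +
      ‖dU r (sinMode k) + eigenvalue k * U r (sinMode k)‖ₑ ^ 2 with hR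
  have hmeas : ∀ v : SmoothFun d, ∀ l : ℝ, AEMeasurable (fun r => ‖dU r v + l * U r v‖ₑ ^ 2)
      (volume.restrict (Ioc t₀ t)) := fun v l =>
    (((hdU.1 v).mono_set hsub).add (((hU.mem.1 v).mono_set hsub).const_mul l)).enorm.pow_const 2
  have hRm : ∀ k, AEMeasurable (R k) (volume.restrict (Ioc t₀ t)) := fun k =>
    (hmeas _ _).add (hmeas _ _)
  have hmode : ∀ k, ENNReal.ofReal (weight k) * ‖distFourierCoeff (U t) k‖ₑ ^ 2 ≤
      2 * (ENNReal.ofReal (weight k * Real.exp (-(2 * eigenvalue k * (t - t₀)))) *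
        ‖distFourierCoeff (U t₀) k‖ₑ ^ 2) +
      2 * ENNReal.ofReal (T + 1) * ∫⁻ r in Ioc t₀ t, R k r := fun k => by
    have hc := (hder (cosMode k)).weight_mul_sq_le (hU.mem.1 _) (eigenvalue_nonneg k) h0 h1 h2
    have hs := (hder (sinMode k)).weight_mul_sq_le (hU.mem.1 _) (eigenvalue_nonneg k) h0 h1 h2
    rw [lintegral_add_left' (hmeas _ _), enorm_distFourierCoeff_sq, enorm_distFourierCoeff_sq]
    refine le_trans (le_of_eq (mul_add _ _ _)) ((add_le_add hc hs).trans_eq ?_)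
    unfold weight
    ring
  have hRle : ∀ᵐ r ∂(volume.restrict (Ioc t₀ t)),
      ∑' k, ENNReal.ofReal (weight k ^ s) * R k r ≤ C * energy s (U r) := by
    filter_upwards [ae_restrict_of_ae_restrict_of_subset hsub heq,
      ae_restrict_mem measurableSet_Ioc] with r hr hrm
    refine le_trans (le_of_eq ?_) (hmul (V r) (fun b => hV b r (hsub hrm)) (U r))
    refine tsum_congr fun k => ?_
    have e1 : dU r (cosMode k) + eigenvalue k * U r (cosMode k) = U r (V r * cosMode k) := by
      have := hr (cosMode k)
      rw [laplacian_cosMode, map_smul, smul_eq_mul] at this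
      linarith
    have e2 : dU r (sinMode k) + eigenvalue k * U r (sinMode k) = U r (V r * sinMode k) := by
      have := hr (sinMode k)
      rw [laplacian_sinMode, map_smul, smul_eq_mul] at this
      linarith
    simp only [hR, e1, e2]
  calc energy (s + 1) (U t) = ∑' k, ENNReal.ofReal (weight k ^ s) *
        (ENNReal.ofReal (weight k) * ‖distFourierCoeff (U t) k‖ₑ ^ 2) := by
        refine tsum_congr fun k => ?_
        rw [Real.rpow_add_one (weight_pos k).ne',
          ENNReal.ofReal_mul (Real.rpow_nonneg (weight_pos k).le s), mul_assoc]
    _ ≤ ∑' k, ENNReal.ofReal (weight k ^ s) *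
        (2 * (ENNReal.ofReal (weight k * Real.exp (-(2 * eigenvalue k * (t - t₀)))) *
          ‖distFourierCoeff (U t₀) k‖ₑ ^ 2) +
        2 * ENNReal.ofReal (T + 1) * ∫⁻ r in Ioc t₀ t, R k r) := by
        gcongr with k
        exact hmode k
    _ = 2 * ∑' k, ENNReal.ofReal (weight k ^ s) *
          (ENNReal.ofReal (weight k * Real.exp (-(2 * eigenvalue k * (t - t₀)))) *
            ‖distFourierCoeff (U t₀) k‖ₑ ^ 2) +
        2 * ENNReal.ofReal (T + 1) *
          ∫⁻ r in Ioc t₀ t, ∑' k, ENNReal.ofReal (weight k ^ s) * R k r := by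
        rw [lintegral_tsum fun k => (hRm k).const_mul _, ← ENNReal.tsum_mul_left,
          ← ENNReal.tsum_mul_left, ← ENNReal.tsum_add]
        refine tsum_congr fun k => ?_
        rw [lintegral_const_mul'' _ (hRm k)]
        ring
    _ ≤ _ := by
        rw [mul_assoc (2 * ENNReal.ofReal (T + 1)) C]
        gcongr
        refine (lintegral_mono_ae hRle).trans_eq ?_
        rw [lintegral_const_mul'' _ (hU.mem.aemeasurable_energy.mono_set hsub)]

theorem IsWeakSolution.energy_initial {T a : ℝ} {V : ℝ → SmoothFun d} {h : PeriodicDistribution d}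
    {U : ℝ → PeriodicDistribution d} (hU : IsWeakSolution T a V h U) : energy a h ≠ ⊤ := by
  rw [energy_eq]
  exact ENNReal.pow_ne_top hU.initial_mem.ne

/-- The energy estimate in the space of the initial value. -/
theorem exists_energy_le {T : ℝ} (hT : 0 < T) (a : ℝ) {V : ℝ → SmoothFun d} {M : ℕ → ℝ}
    (hV : ∀ b, ∀ t ∈ Icc 0 T, CBound b (V t) (M b)) : ∃ C : ℝ≥0∞, C ≠ ⊤ ∧
    ∀ {h : PeriodicDistribution d} {U : ℝ → PeriodicDistribution d},
      IsWeakSolution T a V h U → ∀ t ∈ Icc 0 T, energy a (U t) ≤ C * energy a h := by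
  obtain ⟨C, hC, hstep⟩ := exists_energy_add_one_le T (a - 1) hV
  -- The added `1` makes the Grönwall constant strictly positive.
  set K : ℝ := C.toReal + 1
  have hK : 0 < K := by positivity
  refine ⟨ENNReal.ofReal (1 + K * T * (1 + Real.exp (K * T))) * 2, by finiteness, ?_⟩
  intro h U hU t ht
  have hne := hU.energy_initial
  have hA : ENNReal.ofReal (2 * energy a h).toReal = 2 * energy a h :=
    ENNReal.ofReal_toReal (by finiteness)
  -- Grönwall's inequality needs a priori integrability, which comes from `U ∈ L²([0,T], H^(a+1))`.
  have hfin : ∫⁻ t in Icc 0 T, energy a (U t) ≠ ⊤ := by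
    refine ne_top_of_le_ne_top hU.mem.2.ne (lintegral_mono fun t => ?_)
    rw [← energy_eq]
    exact energy_mono (by linarith) _
  have key := le_mul_of_le_add_mul_lintegral hK (ENNReal.toReal_nonneg (a := 2 * energy a h))
    hU.mem.aemeasurable_energy hfin (fun t ht => ?_) ht
  · refine key.trans_eq ?_
    rw [ENNReal.ofReal_mul (by positivity), hA]
    exact (mul_assoc _ _ _).symm
  · have h1 := hstep hU 0 t le_rfl ht.1 ht.2
    rw [sub_add_cancel, hU.initial] at h1
    refine h1.trans (add_le_add ?_ (mul_le_mul' ?_ (lintegral_mono fun r =>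
      energy_mono (by linarith) _)))
    · rw [hA]
      refine mul_le_mul_right (ENNReal.tsum_le_tsum fun k => ?_) _
      rw [← mul_assoc]
      refine mul_le_mul_left ?_ _
      have hw := weight_pos k
      rw [← ENNReal.ofReal_mul (by positivity)]
      refine ENNReal.ofReal_le_ofReal ?_
      have h2 : Real.exp (-(2 * eigenvalue k * (t - 0))) ≤ 1 := by
        rw [Real.exp_le_one_iff]
        have := mul_nonneg (eigenvalue_nonneg k) ht.1
        linarith
      calc weight k ^ (a - 1) * (weight k * Real.exp (-(2 * eigenvalue k * (t - 0))))
          ≤ weight k ^ (a - 1) * (weight k * 1) := by gcongr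
        _ = weight k ^ a := by
          rw [mul_one, ← Real.rpow_add_one hw.ne', sub_add_cancel]
    · rw [← ENNReal.ofReal_toReal hC]
      exact ENNReal.ofReal_le_ofReal (by simp [K])

/-- Bootstrapping the smoothing estimate. -/
theorem exists_energy_add_nat_le {T : ℝ} (hT : 0 < T) (a : ℝ) {V : ℝ → SmoothFun d} {M : ℕ → ℝ}
    (hV : ∀ b, ∀ t ∈ Icc 0 T, CBound b (V t) (M b)) (n : ℕ) {t₁ : ℝ} (ht₁ : 0 < t₁) :
    ∃ C : ℝ≥0∞, C ≠ ⊤ ∧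
    ∀ {h : PeriodicDistribution d} {U : ℝ → PeriodicDistribution d},
      IsWeakSolution T a V h U → ∀ t ∈ Icc t₁ T, energy (a + n) (U t) ≤ C * energy a h := by
  induction n generalizing t₁ with
  | zero =>
    obtain ⟨C, hC, hle⟩ := exists_energy_le hT a hV
    exact ⟨C, hC, fun hU t ht => by simpa using hle hU t ⟨ht₁.le.trans ht.1, ht.2⟩⟩
  | succ n ih =>
    obtain ⟨C₁, hC₁, hle⟩ := ih (half_pos ht₁)
    obtain ⟨C₂, hC₂, hstep⟩ := exists_energy_add_one_le T (a + n) hV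
    -- Restart at `t₁ / 2`: the elapsed time `τ` is at least `t₁ / 2`, so `1 + 1 / (2τ) ≤ 1 + 1 /
    -- t₁`. The second term integrates the induction bound over an interval of length at most `T`.
    refine ⟨2 * (ENNReal.ofReal (1 + 1 / t₁) * C₁) + C₂ * (ENNReal.ofReal T * C₁),
      by finiteness, ?_⟩
    intro h U hU t ht
    have h0 : t₁ / 2 ≤ t := by linarith [ht.1]
    have h1 := hstep hU (t₁ / 2) t (by linarith) h0 ht.2
    have hcast : a + ((n + 1 : ℕ) : ℝ) = a + n + 1 := by push_cast; ring
    rw [hcast, add_mul, mul_assoc, mul_assoc, mul_assoc, mul_assoc]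
    refine h1.trans (add_le_add (mul_le_mul_right ?_ _) (mul_le_mul_right ?_ _))
    · calc _ ≤ ∑' k, ENNReal.ofReal (1 + 1 / t₁) *
            (ENNReal.ofReal (weight k ^ (a + n)) * ‖distFourierCoeff (U (t₁ / 2)) k‖ₑ ^ 2) := by
            refine ENNReal.tsum_le_tsum fun k => ?_
            rw [mul_left_comm]
            refine mul_le_mul_left (ENNReal.ofReal_le_ofReal ?_) _
            have hτ : 0 < t - t₁ / 2 := by linarith [ht.1]
            refine (one_add_mul_exp_le (eigenvalue_nonneg k) hτ).trans ?_
            gcongr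
            linarith [ht.1]
        _ ≤ _ := by
            rw [ENNReal.tsum_mul_left]
            gcongr
            exact hle hU _ ⟨le_rfl, h0.trans ht.2⟩
    · calc ∫⁻ r in Ioc (t₁ / 2) t, energy (a + n) (U r)
          ≤ ∫⁻ _r in Ioc (t₁ / 2) t, C₁ * energy a h :=
            setLIntegral_mono' measurableSet_Ioc fun r hr => hle hU r ⟨hr.1.le, hr.2.trans ht.2⟩
        _ ≤ _ := by
            rw [setLIntegral_const, mul_comm, Real.volume_Ioc]
            gcongr
            linarith [ht.2]

end TorusPDE

end

open TorusPDE
theorem lemma3p7 (d : ℕ) (T tmin a b : ℝ) (hT : 0 < T) (htmin : 0 < tmin) (hab : a < b)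
    (V : ℝ → SmoothFun d) (hV : MemCOneInfty T V) :
    ∃ c : ℝ, 0 < c ∧ ∀ (h : PeriodicDistribution d) (U : ℝ → PeriodicDistribution d),
      IsWeakSolution T a V h U →
        (⨆ t ∈ Icc tmin T, sobolevNorm b (U t)) ≤ ENNReal.ofReal c * sobolevNorm a h := by
  obtain ⟨_, _, hM⟩ := hV
  choose M hM using hM
  obtain ⟨n, hn⟩ := exists_nat_ge (b - a)
  obtain ⟨C, hC, hle⟩ := exists_energy_add_nat_le hT a (fun b t ht => (hM b).1 t ht) n htmin
  -- The energies are squared norms, so `c ^ 2 ≥ C` is required; `C + 1` satisfies this without a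
  -- square root and is positive.
  refine ⟨C.toReal + 1, by positivity, fun h U hU => iSup₂_le fun t ht => ?_⟩
  have h1 : sobolevNorm b (U t) ^ 2 ≤ C * sobolevNorm a h ^ 2 := by
    rw [← energy_eq, ← energy_eq]
    exact (energy_mono (by linarith) _).trans (hle hU t ht)
  have h2 : C ≤ ENNReal.ofReal (C.toReal + 1) ^ 2 := by
    rw [← ENNReal.ofReal_pow (by positivity)]
    conv_lhs => rw [← ENNReal.ofReal_toReal hC]
    refine ENNReal.ofReal_le_ofReal ?_
    nlinarith [ENNReal.toReal_nonneg (a := C)]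
  rw [← ENNReal.pow_le_pow_left_iff two_ne_zero, mul_pow]
  exact h1.trans (mul_le_mul_left h2 _)
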